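/- Let $\Delta^d=\{x\in\mathbb{R}_{\ge 0}^d:\sum_i x_i=1\}$. For a payoff matrix $A\in\mathbb{R}^{n\times m}$ consider the zero-sum game $\min_{x\in\Delta^n}\max_{y\in\Delta^m}\langle x,Ay\rangle$, with duality gap $$\Phi_A(x,y)=\max_{y'\in\Delta^m}\langle x,Ay'\rangle-\min_{x'\in\Delta^n}\langle x',Ay\rangle ,\qquad (x,y)\in\Delta^n\times\Delta^m ,$$ and call $(x^\star,y^\star)\in\Delta^n\times\Delta^m$ an equilibrium if $\langle x^\star,Ay\rangle\le\langle x^\star,Ay^\star\rangle\le\langle x,Ay^\star\rangle$ for all $x\in\Delta^n$, $y\in\Delta^m$. For every real polynomial $q$ that is positive at all positive integers there is a real polynomial $p$ in three variables such that the following holds for all integers $n,m\ge 1$, every $\bar A\in[-1,1]^{n\times m}$ and every $\sigma$ with $0<\sigma\le 1$. Let $A=\bar A+G$, where the entries of $G$ are independent Gaussian random variables with mean $0$ and variance $\sigma^2$. Then with probability at least $1-\frac{1}{q(nm)}$ over $G$, the game $A$ has a unique equilibrium $z^\star=(x^\star,y^\star)$, and for every $\epsilon\in\mathbb{R}$ and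 every $z=(x,y)\in\Delta^n\times\Delta^m$ with $\Phi_A(z)\le\epsilon$, $$\|z-z^\star\|\le\epsilon\cdot p(n,m,1/\sigma),$$ where $\|\cdot\|$ is the Euclidean norm on $\mathbb{R}^{n+m}$. -/

import Mathlib

open MeasureTheory ProbabilityTheory
open scoped Matrix

noncomputable section

/-- The payoff `⟨x, A y⟩` that Player `x` minimizes and Player `y` maximizes. -/
def payoff {n m : ℕ} (A : Matrix (Fin n) (Fin m) ℝ) (x : Fin n → ℝ) (y : Fin m → ℝ) : ℝ :=
  x ⬝ᵥ (A *ᵥ y)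

/-- The duality gap `max_{y' ∈ Δ^m} ⟨x, A y'⟩ - min_{x' ∈ Δ^n} ⟨x', A y⟩`. For `n, m ≥ 1` the
simplices are nonempty and compact, so the supremum and the infimum are attained. -/
def dualityGap {n m : ℕ} (A : Matrix (Fin n) (Fin m) ℝ) (x : Fin n → ℝ) (y : Fin m → ℝ) : ℝ :=
  (⨆ y' : stdSimplex ℝ (Fin m), payoff A x y') - ⨅ x' : stdSimplex ℝ (Fin n), payoff A x' y

/-- The set of equilibria (saddle points) of `min_{x ∈ Δ^n} max_{y ∈ Δ^m} ⟨x, A y⟩`. -/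
def equilibria {n m : ℕ} (A : Matrix (Fin n) (Fin m) ℝ) : Set ((Fin n → ℝ) × (Fin m → ℝ)) :=
  {z | z.1 ∈ stdSimplex ℝ (Fin n) ∧ z.2 ∈ stdSimplex ℝ (Fin m) ∧
    (∀ x' ∈ stdSimplex ℝ (Fin n), payoff A z.1 z.2 ≤ payoff A x' z.2) ∧
    (∀ y' ∈ stdSimplex ℝ (Fin m), payoff A z.1 y' ≤ payoff A z.1 z.2)}

/-- The concatenation `(x, y)` as a vector of the Euclidean space `ℝ^{n+m}`. -/
def concatStrategies {n m : ℕ} (x : Fin n → ℝ) (y : Fin m → ℝ) : EuclideanSpace ℝ (Fin n ⊕ Fin m) :=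
  WithLp.toLp 2 (Sum.elim x y)

/-- The law of an `n × m` array of independent Gaussians with mean `0` and variance `σ ^ 2`. -/
def gaussianNoise (n m : ℕ) (σ : ℝ) : Measure (Fin n → Fin m → ℝ) :=
  Measure.pi fun _ => Measure.pi fun _ => gaussianReal 0 (σ ^ 2).toNNReal

end

/-! For a row strategy `x` put f(x) = `maxPay A x`, a convex piecewise linear function on the
simplex. Up to the value of the game, the duality gap is the excess of f over its minimum plus the
same excess for the column player, whose game is the negated transpose `swapGame A`. If both
functions have a sharp minimum with modulus t, the equilibrium is unique and the distance to it is
at most (n+m)/t times the gap (`error_bound_of_sharp`). It remains to bound P, the probability that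
`Sharp t A` fails, for a t that is polynomially small.

Let A be a game with bounded entries and unique minimax strategy x that is not sharp, and fix a
radius β. If no constraint inactive at x becomes active within sup-distance β, f is a cone around x
there. Failure of sharpness then yields a point at distance β where f has grown by less than tβ, and
tilting f by ±t times one coordinate, which is a shift of one row of A, makes the minimizer jump by
β (`exists_jump_of_gap`).

Jumps are rare: along a line of row shifts the coordinate of the minimizer is monotone and stays in
[0,1], so at most 1/β of K successive shifts see a jump (`card_jump_le`). Small displacements change
the Gaussian density by a factor at most 3, so averaging over the shifts gives probability O(1/(βK))
(`gaussLaw_jump_le`).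

Otherwise some positive slack or some positive coordinate of x is small. These events are bounded
relative to P itself: lowering an inactive column, or a volume preserving shear that translates the
landscape of f, increases that slack or coordinate in steps and keeps the game non-sharp. The L
displaced copies are almost surely disjoint inside the non-sharp games, so such an event has
probability at most 3P/L (`gaussLaw_slice_le`). With L = 6(m+n²) all of them together cost P/2,
which is absorbed on the left (`gaussLaw_not_sharp_le`). -/

section Game

/-! ### Payoff functions, their minimizers, and row shifts. -/

variable {ι κ : Type*} [Fintype ι]

/-- The payoff of the mixed strategy `x` against the pure column `j`. -/
def colPay (A : ι → κ → ℝ) (x : ι → ℝ) (j : κ) : ℝ := ∑ i, x i * A i j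

/-- The worst case payoff of the row strategy `x`. -/
def maxPay [Fintype κ] [Nonempty κ] (A : ι → κ → ℝ) (x : ι → ℝ) : ℝ :=
  Finset.univ.sup' Finset.univ_nonempty (colPay A x)

/-- `x` is a minimax strategy. -/
def IsOpt [Fintype κ] [Nonempty κ] (A : ι → κ → ℝ) (x : ι → ℝ) : Prop :=
  x ∈ stdSimplex ℝ ι ∧ ∀ z ∈ stdSimplex ℝ ι, maxPay A x ≤ maxPay A z

/-- The worst case payoff has a sharp minimum with modulus `t`. -/
def Sharp [Fintype κ] [Nonempty κ] (t : ℝ) (A : ι → κ → ℝ) : Prop :=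
  ∃ x ∈ stdSimplex ℝ ι, ∀ z ∈ stdSimplex ℝ ι, maxPay A x + t * ‖z - x‖ ≤ maxPay A z

/-- The matrix `A` with `c` added to all entries of row `l`. -/
def rowShift [DecidableEq ι] (l : ι) (c : ℝ) (A : ι → κ → ℝ) : ι → κ → ℝ :=
  fun i j => A i j + if i = l then c else 0

/-- The matrix `A` with `c` added to all entries of column `j`. -/
def colShift [DecidableEq κ] (j : κ) (c : ℝ) (A : ι → κ → ℝ) : ι → κ → ℝ :=
  fun i k => A i k + if k = j then c else 0

/-- The matrix whose landscape of payoffs is that of `A` translated by `c • (e_r - e_l)`. -/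
def shear (r l : ι) (c : ℝ) (A : ι → κ → ℝ) : ι → κ → ℝ :=
  fun i j => A i j - c * (A r j - A l j)

lemma colPay_add (A : ι → κ → ℝ) (x y : ι → ℝ) (j : κ) :
    colPay A (x + y) j = colPay A x j + colPay A y j := by
  simp [colPay, add_mul, Finset.sum_add_distrib]

lemma colPay_smul (A : ι → κ → ℝ) (c : ℝ) (x : ι → ℝ) (j : κ) :
    colPay A (c • x) j = c * colPay A x j := by
  simp [colPay, mul_assoc, Finset.mul_sum]

lemma colPay_sub (A : ι → κ → ℝ) (x y : ι → ℝ) (j : κ) :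
    colPay A (x - y) j = colPay A x j - colPay A y j := by
  simp [colPay, sub_mul, Finset.sum_sub_distrib]

lemma colPay_le_of_norm_le {A : ι → κ → ℝ} {R : ℝ} (hA : ∀ i j, |A i j| ≤ R) (x : ι → ℝ) (j : κ) :
    |colPay A x j| ≤ Fintype.card ι * R * ‖x‖ := by
  unfold colPay
  calc |∑ i, x i * A i j| ≤ ∑ i, |x i * A i j| := Finset.abs_sum_le_sum_abs _ _
    _ ≤ ∑ _i : ι, ‖x‖ * R := by
        refine Finset.sum_le_sum fun i _ => ?_
        rw [abs_mul]
        exact mul_le_mul (norm_le_pi_norm x i) (hA i j) (abs_nonneg _) (norm_nonneg _)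
    _ = Fintype.card ι * R * ‖x‖ := by simp; ring

lemma colPay_segment (A : ι → κ → ℝ) (x z : ι → ℝ) (θ : ℝ) (j : κ) :
    colPay A (x + θ • (z - x)) j = (1 - θ) * colPay A x j + θ * colPay A z j := by
  rw [colPay_add, colPay_smul, colPay_sub]; ring

lemma segment_mem_stdSimplex {x z : ι → ℝ} (hx : x ∈ stdSimplex ℝ ι) (hz : z ∈ stdSimplex ℝ ι)
    {θ : ℝ} (h0 : 0 ≤ θ) (h1 : θ ≤ 1) : x + θ • (z - x) ∈ stdSimplex ℝ ι := by
  have := (convex_stdSimplex ℝ ι) hx hz (sub_nonneg.2 h1) h0 (by ring)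
  convert this using 1
  module

/-- The translation adds `c` times the difference of rows `r` and `l`, which the shear leaves
unchanged; since `z` has mass one, the multiple subtracted from every row cancels exactly this. -/
lemma colPay_shear (r l : ι) [DecidableEq ι] (c : ℝ) (A : ι → κ → ℝ) (z : ι → ℝ)
    (hz : ∑ i, z i = 1) (j : κ) :
    colPay (shear r l c A) (z + c • (Pi.single r 1 - Pi.single l 1)) j = colPay A z j := by
  have h : ∀ B : ι → κ → ℝ, colPay B (z + c • (Pi.single r 1 - Pi.single l 1)) j
      = colPay B z j + c * (B r j - B l j) := by
    intro B
    rw [colPay_add, colPay_smul, colPay_sub]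
    simp [colPay, Pi.single_apply]
  rw [h]
  have : colPay (shear r l c A) z j = colPay A z j - c * (A r j - A l j) := by
    simp only [colPay, shear, mul_sub, Finset.sum_sub_distrib]
    simp only [← Finset.sum_mul, hz]
    ring
  rw [this]
  simp [shear]

section Max

variable [Fintype κ] [Nonempty κ]

lemma colPay_le_maxPay (A : ι → κ → ℝ) (x : ι → ℝ) (j : κ) : colPay A x j ≤ maxPay A x :=
  Finset.le_sup' (colPay A x) (Finset.mem_univ j)

lemma exists_colPay_eq (A : ι → κ → ℝ) (x : ι → ℝ) : ∃ j, maxPay A x = colPay A x j := by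
  obtain ⟨j, -, hj⟩ := Finset.exists_mem_eq_sup' Finset.univ_nonempty (colPay A x)
  exact ⟨j, hj⟩

lemma maxPay_le {A : ι → κ → ℝ} {x : ι → ℝ} {c : ℝ} (h : ∀ j, colPay A x j ≤ c) :
    maxPay A x ≤ c :=
  Finset.sup'_le _ _ fun j _ => h j

lemma maxPay_segment_le (A : ι → κ → ℝ) (x z : ι → ℝ) {θ : ℝ} (h0 : 0 ≤ θ) (h1 : θ ≤ 1) :
    maxPay A (x + θ • (z - x)) ≤ (1 - θ) * maxPay A x + θ * maxPay A z := by
  refine maxPay_le fun j => ?_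
  rw [colPay_segment]
  have := colPay_le_maxPay A x j
  have := colPay_le_maxPay A z j
  gcongr

lemma continuous_maxPay : Continuous fun p : (ι → κ → ℝ) × (ι → ℝ) => maxPay p.1 p.2 := by
  unfold maxPay
  apply Continuous.finset_sup'_apply
  intro j _
  unfold colPay
  fun_prop

lemma continuous_maxPay_right (A : ι → κ → ℝ) : Continuous (maxPay A) :=
  continuous_maxPay.comp (by fun_prop : Continuous fun x : ι → ℝ => (A, x))

lemma exists_isOpt [Nonempty ι] (A : ι → κ → ℝ) : ∃ x, IsOpt A x := by
  classical
  obtain ⟨x, hx, h⟩ := (isCompact_stdSimplex ℝ ι).exists_isMinOn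
    ⟨_, single_mem_stdSimplex ℝ (Classical.arbitrary ι)⟩ (continuous_maxPay_right A).continuousOn
  exact ⟨x, hx, fun z hz => h hz⟩

lemma maxPay_rowShift [DecidableEq ι] (l : ι) (c : ℝ) (A : ι → κ → ℝ) (x : ι → ℝ) :
    maxPay (rowShift l c A) x = maxPay A x + c * x l := by
  have h : ∀ j, colPay (rowShift l c A) x j = colPay A x j + c * x l := fun j => by
    simp [colPay, rowShift, mul_add, Finset.sum_add_distrib, mul_comm]
  apply le_antisymm
  · exact maxPay_le fun j => by rw [h]; linarith [colPay_le_maxPay A x j]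
  · obtain ⟨j, hj⟩ := exists_colPay_eq A x
    rw [hj, ← h]; exact colPay_le_maxPay _ _ _

/-- A row shift adds a linear term in coordinate `l`; adding the two optimality inequalities shows
that this coordinate of the minimizer is antitone in the shift. -/
lemma isOpt_rowShift_mono [DecidableEq ι] {A : ι → κ → ℝ} {l : ι} {a b : ℝ} {u w : ι → ℝ}
    (hu : IsOpt (rowShift l a A) u) (hw : IsOpt (rowShift l b A) w) :
    0 ≤ (a - b) * (w l - u l) := by
  have h1 := hu.2 w hw.1
  have h2 := hw.2 u hu.1
  simp only [maxPay_rowShift] at h1 h2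
  linarith

lemma maxPay_shear (r l : ι) [DecidableEq ι] (c : ℝ) (A : ι → κ → ℝ) (z : ι → ℝ)
    (hz : ∑ i, z i = 1) :
    maxPay (shear r l c A) (z + c • (Pi.single r 1 - Pi.single l 1)) = maxPay A z := by
  unfold maxPay
  congr 1
  funext j
  exact colPay_shear r l c A z hz j

lemma Sharp.unique {t : ℝ} (ht : 0 < t) {A : ι → κ → ℝ} {x : ι → ℝ} (hx : x ∈ stdSimplex ℝ ι)
    (h : ∀ z ∈ stdSimplex ℝ ι, maxPay A x + t * ‖z - x‖ ≤ maxPay A z) {w : ι → ℝ}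
    (hw : IsOpt A w) : w = x := by
  have h1 := h w hw.1
  have h2 := hw.2 x hx
  have : ‖w - x‖ ≤ 0 := by
    by_contra hc
    have := mul_pos ht (not_le.1 hc)
    linarith
  exact sub_eq_zero.1 (norm_le_zero_iff.1 this)

/-- A minimax strategy which is the only one. -/
def IsStrictOpt (A : ι → κ → ℝ) (x : ι → ℝ) : Prop :=
  x ∈ stdSimplex ℝ ι ∧ ∀ z ∈ stdSimplex ℝ ι, z ≠ x → maxPay A x < maxPay A z

lemma IsStrictOpt.isOpt {A : ι → κ → ℝ} {x : ι → ℝ} (h : IsStrictOpt A x) : IsOpt A x :=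
  ⟨h.1, fun z hz => by
    rcases eq_or_ne z x with rfl | hne
    · rfl
    · exact (h.2 z hz hne).le⟩

lemma IsOpt.isStrictOpt {A : ι → κ → ℝ} {x : ι → ℝ} (h : IsOpt A x)
    (hu : ∀ w, IsOpt A w → w = x) : IsStrictOpt A x :=
  ⟨h.1, fun z hz hne => lt_of_le_of_ne (h.2 z hz) fun he =>
    hne (hu z ⟨hz, fun w hw => he ▸ h.2 w hw⟩)⟩

lemma IsStrictOpt.sharp {t : ℝ} (ht : 0 ≤ t) {A : ι → κ → ℝ} {x : ι → ℝ} (h : IsStrictOpt A x)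
    (hs : Sharp t A) : ∀ z ∈ stdSimplex ℝ ι, maxPay A x + t * ‖z - x‖ ≤ maxPay A z := by
  obtain ⟨w, hw, hs⟩ := hs
  have : w = x := by
    by_contra hne
    have := hs x h.1
    have := h.2 w hw hne
    have := mul_nonneg ht (norm_nonneg (x - w))
    linarith
  exact this ▸ hs

end Max

lemma exists_small_step {a : ℝ} (ha : 0 < a) (b : ℝ) :
    ∃ θ : ℝ, 0 < θ ∧ θ ≤ 1 ∧ 0 < a + θ * b := by
  refine ⟨min 1 (a / (2 * (|b| + 1))), by positivity, min_le_left _ _, ?_⟩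
  have h1 : min 1 (a / (2 * (|b| + 1))) * |b| ≤ a / (2 * (|b| + 1)) * (|b| + 1) := by
    gcongr
    · exact min_le_right _ _
    · linarith
  have h2 : a / (2 * (|b| + 1)) * (|b| + 1) = a / 2 := by
    field_simp
  have h3 : -(min 1 (a / (2 * (|b| + 1))) * |b|) ≤ min 1 (a / (2 * (|b| + 1))) * b := by
    rw [← mul_neg]
    have : 0 ≤ min 1 (a / (2 * (|b| + 1))) := by positivity
    exact mul_le_mul_of_nonneg_left (neg_abs_le b) this
  linarith

/-! ### Lowering an inactive column. -/

section ColShift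

variable [DecidableEq κ]

lemma colPay_colShift {A : ι → κ → ℝ} {x : ι → ℝ} (hx : ∑ i, x i = 1) (j k : κ) (c : ℝ) :
    colPay (colShift j c A) x k = colPay A x k + if k = j then c else 0 := by
  unfold colPay colShift
  simp only [mul_add, Finset.sum_add_distrib, ← Finset.sum_mul, hx, one_mul]

variable [Fintype κ] [Nonempty κ]

lemma maxPay_colShift_le {A : ι → κ → ℝ} {x : ι → ℝ} (hx : ∑ i, x i = 1) (j : κ) {c : ℝ}
    (hc : c ≤ 0) : maxPay (colShift j c A) x ≤ maxPay A x := by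
  refine maxPay_le fun k => ?_
  rw [colPay_colShift hx]
  have := colPay_le_maxPay A x k
  split_ifs <;> linarith

lemma maxPay_colShift_eq {A : ι → κ → ℝ} {x : ι → ℝ} (hx : ∑ i, x i = 1) {j : κ} {c : ℝ}
    (hc : c ≤ 0) (hj : colPay A x j < maxPay A x) : maxPay (colShift j c A) x = maxPay A x := by
  refine le_antisymm (maxPay_colShift_le hx j hc) ?_
  obtain ⟨k, hk⟩ := exists_colPay_eq A x
  have hkj : k ≠ j := by rintro rfl; exact absurd hk hj.ne'
  have := colPay_le_maxPay (colShift j c A) x k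
  rw [colPay_colShift hx, if_neg hkj] at this
  linarith

/-- Column `j` is inactive near `x`, so lowering it changes nothing there. By convexity a competitor
anywhere gives one close to `x`, hence one for `A`. -/
lemma IsStrictOpt.colShift {A : ι → κ → ℝ} {x : ι → ℝ} (h : IsStrictOpt A x) {j : κ} {c : ℝ}
    (hc : c ≤ 0) (hj : colPay A x j < maxPay A x) : IsStrictOpt (colShift j c A) x := by
  refine ⟨h.1, fun z hz hne => ?_⟩
  by_contra hle
  rw [not_lt, maxPay_colShift_eq h.1.2 hc hj] at hle
  obtain ⟨θ, hθ, hθ1, hpos⟩ := exists_small_step (sub_pos.2 hj) (colPay A x j - colPay A z j)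
  have hmem := segment_mem_stdSimplex h.1 hz hθ.le hθ1
  have hne' : x + θ • (z - x) ≠ x := by
    simp [hθ.ne', sub_eq_zero, hne]
  have h1 := h.2 _ hmem hne'
  refine absurd h1 (not_lt.2 (maxPay_le fun k => ?_))
  by_cases hk : k = j
  · subst hk
    rw [colPay_segment]
    nlinarith
  · have h2 := colPay_colShift hmem.2 (A := A) j k c
    rw [if_neg hk, add_zero] at h2
    rw [← h2]
    refine (colPay_le_maxPay _ _ _).trans ((maxPay_segment_le _ _ _ hθ.le hθ1).trans ?_)
    rw [maxPay_colShift_eq h.1.2 hc hj]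
    nlinarith

/-- Lowering the column keeps the value at `x` and raises no other value, so sharpness passes back
to `A`. Used in contrapositive form: non-sharpness survives the displacement. -/
lemma IsStrictOpt.sharp_of_colShift {A : ι → κ → ℝ} {x : ι → ℝ} (h : IsStrictOpt A x) {j : κ}
    {c t : ℝ} (ht : 0 ≤ t) (hc : c ≤ 0) (hj : colPay A x j < maxPay A x)
    (hs : Sharp t (_root_.colShift j c A)) : Sharp t A := by
  refine ⟨x, h.1, fun z hz => ?_⟩
  have := (h.colShift hc hj).sharp ht hs z hz
  rw [maxPay_colShift_eq h.1.2 hc hj] at this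
  exact this.trans (maxPay_colShift_le hz.2 j hc)

end ColShift

/-! ### Translating the payoff landscape by a shear. -/

section Shear

variable [Fintype κ] [Nonempty κ] [DecidableEq ι]

lemma add_shear_mem {x : ι → ℝ} (hx : ∑ i, x i = 1) {r l : ι} {c : ℝ} :
    ∑ i, (x + c • (Pi.single r 1 - Pi.single l 1) : ι → ℝ) i = 1 := by
  simp [Finset.sum_add_distrib, ← Finset.mul_sum, Finset.sum_sub_distrib, hx]

/-- Pulled back, a competitor may have a negative coordinate `r`. As `x r` is positive, a short step
from `x` towards it stays in the simplex, and convexity transfers the strict inequality. -/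
lemma IsStrictOpt.shear {A : ι → κ → ℝ} {x : ι → ℝ} (h : IsStrictOpt A x) {r l : ι} (hrl : r ≠ l)
    {c : ℝ} (hc : 0 ≤ c) (hr : 0 < x r) (hl : c < x l) :
    IsStrictOpt (shear r l c A) (x + c • (Pi.single r 1 - Pi.single l 1)) := by
  refine ⟨⟨fun i => ?_, add_shear_mem h.1.2⟩, fun z' hz' hne => ?_⟩
  · have := h.1.1 i
    by_cases h1 : i = r
    · subst h1; simp [hrl]; linarith
    · by_cases h2 : i = l
      · subst h2; simp [h1]; linarith
      · simp [h1, h2, this]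
  · obtain ⟨z, rfl⟩ : ∃ z, z' = z + c • (Pi.single r 1 - Pi.single l 1) :=
      ⟨z' - c • (Pi.single r 1 - Pi.single l 1), by simp⟩
    have hz1 : ∑ i, z i = 1 := by
      have := hz'.2
      simpa [Finset.sum_add_distrib, ← Finset.mul_sum, Finset.sum_sub_distrib] using this
    rw [maxPay_shear _ _ _ _ _ h.1.2, maxPay_shear _ _ _ _ _ hz1]
    have hzx : z ≠ x := fun e => hne (by rw [e])
    have hznn : ∀ i, i ≠ r → 0 ≤ z i := fun i hi => by
      have := hz'.1 i
      by_cases h2 : i = l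
      · subst h2; simp [hi] at this; linarith
      · simpa [hi, h2] using this
    obtain ⟨θ, hθ, hθ1, hpos⟩ := exists_small_step hr (z r - x r)
    have hmem : x + θ • (z - x) ∈ stdSimplex ℝ ι := by
      refine ⟨fun i => ?_, ?_⟩
      · by_cases hi : i = r
        · subst hi; simpa using hpos.le
        · have h1 := hznn i hi
          have h2 := h.1.1 i
          simp only [Pi.add_apply, Pi.smul_apply, Pi.sub_apply, smul_eq_mul]
          nlinarith
      · simp [Finset.sum_add_distrib, ← Finset.mul_sum, Finset.sum_sub_distrib, hz1, h.1.2]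
    have h1 := h.2 _ hmem (by simp [hθ.ne', sub_eq_zero, hzx])
    have h2 := maxPay_segment_le A x z hθ.le hθ1
    by_contra hle
    nlinarith

/-- Only points whose coordinate `l` is at least `c` translate into the simplex. Points near `x` do
because `c < x l`, and growth near `x` extends by convexity. -/
lemma IsStrictOpt.sharp_of_shear {A : ι → κ → ℝ} {x : ι → ℝ} (h : IsStrictOpt A x) {r l : ι}
    (hrl : r ≠ l) {c t : ℝ} (ht : 0 ≤ t) (hc : 0 ≤ c) (hr : 0 < x r) (hl : c < x l)
    (hs : Sharp t (_root_.shear r l c A)) : Sharp t A := by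
  refine ⟨x, h.1, fun z hz => ?_⟩
  have h' := h.shear hrl hc hr hl
  have key := h'.sharp ht hs
  obtain ⟨θ, hθ, hθ1, hpos⟩ := exists_small_step (sub_pos.2 hl) (z l - x l)
  have hmem0 := segment_mem_stdSimplex h.1 hz hθ.le hθ1
  have hmem : x + θ • (z - x) + c • (Pi.single r 1 - Pi.single l 1) ∈ stdSimplex ℝ ι := by
    refine ⟨fun i => ?_, add_shear_mem hmem0.2⟩
    have h0 := hmem0.1 i
    by_cases hi : i = r
    · subst hi
      simp [hrl] at h0 ⊢
      linarith
    · by_cases h2 : i = l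
      · subst h2
        simp [hi]
        linarith
      · simpa [hi, h2] using h0
  have h1 := key _ hmem
  rw [maxPay_shear _ _ _ _ _ h.1.2, maxPay_shear _ _ _ _ _ hmem0.2] at h1
  have h2 : x + θ • (z - x) + c • (Pi.single r 1 - Pi.single l 1)
      - (x + c • (Pi.single r 1 - Pi.single l 1)) = θ • (z - x) := by abel
  rw [h2, norm_smul, Real.norm_of_nonneg hθ.le] at h1
  have h3 := maxPay_segment_le A x z hθ.le hθ1
  by_contra hlt
  rw [not_le] at hlt
  nlinarith

end Shear

end Game

/-! ### From failure of sharpness to a jump of the minimizer. -/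

section Gap

variable {ι κ : Type*} [Fintype ι] [Fintype κ] [Nonempty κ]

/-- If no constraint that is inactive at the minimax strategy `x` is active in the cube of radius
`β`, then the payoff grows in the cube at least as fast as on its boundary. -/
lemma maxPay_growth_of_gap {A : ι → κ → ℝ} {x : ι → ℝ} (hx : IsOpt A x) {R β α : ℝ}
    (hA : ∀ i j, |A i j| ≤ R) (hβ : 0 < β)
    (hcol : ∀ j, colPay A x j = maxPay A x ∨
      2 * Fintype.card ι * R * β < maxPay A x - colPay A x j)
    (hrow : ∀ r, x r = 0 ∨ β < x r)
    (hα : ∀ z ∈ stdSimplex ℝ ι, ‖z - x‖ = β → maxPay A x + α * β ≤ maxPay A z) :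
    ∀ z ∈ stdSimplex ℝ ι, maxPay A x + α * ‖z - x‖ ≤ maxPay A z := by
  intro z hz
  rcases eq_or_ne z x with rfl | hne
  · simp
  have hpos : 0 < ‖z - x‖ := norm_pos_iff.2 (sub_ne_zero.2 hne)
  set θ := β / ‖z - x‖ with hθ
  have hθ0 : 0 < θ := by positivity
  have hθm : θ * ‖z - x‖ = β := by rw [hθ]; field_simp
  have hnorm : ‖(x + θ • (z - x)) - x‖ = β := by
    rw [add_sub_cancel_left, norm_smul, Real.norm_of_nonneg hθ0.le, hθm]
  have hmem : x + θ • (z - x) ∈ stdSimplex ℝ ι := by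
    refine ⟨fun r => ?_, ?_⟩
    · rcases hrow r with h | h
      · have := hz.1 r
        simp only [Pi.add_apply, Pi.smul_apply, Pi.sub_apply, smul_eq_mul, h]
        nlinarith
      · have := norm_le_pi_norm ((x + θ • (z - x)) - x) r
        rw [hnorm, Real.norm_eq_abs, Pi.sub_apply] at this
        linarith [(abs_le.1 this).1]
    · simp [Finset.sum_add_distrib, ← Finset.mul_sum, Finset.sum_sub_distrib, hz.2, hx.1.2]
  have h1 := hα _ hmem hnorm
  rcases le_total θ 1 with h | h
  · have h2 := maxPay_segment_le A x z hθ0.le h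
    rw [← hθm] at h1
    by_contra hc
    rw [not_le] at hc
    nlinarith
  -- Here `z` lies inside the cube and the ray is prolonged to the boundary. The column that is
  -- maximal there must be active at `x`, so its payoff is affine on the ray and starts at the
  -- maximum; its growth scales down to `z`.
  · have hbound : ∀ j, |colPay A (x + θ • (z - x)) j - colPay A x j|
        ≤ Fintype.card ι * R * β := fun j => by
      rw [← colPay_sub, ← hnorm]
      exact colPay_le_of_norm_le hA _ j
    obtain ⟨k, hk⟩ := exists_colPay_eq A x
    obtain ⟨j, hj⟩ := exists_colPay_eq A (x + θ • (z - x))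
    have hkm := colPay_le_maxPay A (x + θ • (z - x)) k
    have hact : colPay A x j = maxPay A x := by
      rcases hcol j with h' | h'
      · exact h'
      · have e1 := (abs_le.1 (hbound j)).2
        have e2 := (abs_le.1 (hbound k)).1
        linarith
    have h3 := colPay_segment A x z θ j
    rw [hj, h3, hact] at h1
    have h4 := colPay_le_maxPay A z j
    rw [← hθm] at h1
    by_contra hc
    rw [not_le] at hc
    nlinarith

/-- If the minimum of the payoff is not sharp, and no constraint that is inactive at the minimax
strategy `x` is active in the cube of radius `β`, then a shift of some row by `t` moves the minimax
strategy by `β`. -/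
lemma exists_jump_of_gap [DecidableEq ι] {A : ι → κ → ℝ} {x : ι → ℝ} (hx : IsOpt A x) {R β t : ℝ}
    (hA : ∀ i j, |A i j| ≤ R) (hβ : 0 < β)
    (hcol : ∀ j, colPay A x j = maxPay A x ∨
      2 * Fintype.card ι * R * β < maxPay A x - colPay A x j)
    (hrow : ∀ r, x r = 0 ∨ β < x r) (hs : ¬ Sharp t A) :
    ∃ l, ∃ s : ℝ, (s = 1 ∨ s = -1) ∧
      ∀ w, IsOpt (rowShift l (-(s * t)) A) w → β ≤ s * (w l - x l) := by
  -- If no point of the simplex is at distance `β`, the growth lemma applies vacuously with modulus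
  -- `t`.
  have hne : (stdSimplex ℝ ι ∩ {z | ‖z - x‖ = β}).Nonempty := by
    by_contra hempty
    refine hs ⟨x, hx.1, maxPay_growth_of_gap hx hA hβ hcol hrow fun z hz hzn => ?_⟩
    exact (hempty ⟨z, hz, hzn⟩).elim
  have hcomp : IsCompact (stdSimplex ℝ ι ∩ {z | ‖z - x‖ = β}) :=
    (isCompact_stdSimplex ℝ ι).inter_right (isClosed_eq (by fun_prop) continuous_const)
  obtain ⟨z, ⟨hz, hzn⟩, hmin⟩ := hcomp.exists_isMinOn hne (continuous_maxPay_right A).continuousOn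
  have hzn : ‖z - x‖ = β := hzn
  set α := (maxPay A z - maxPay A x) / β with hα
  have hαβ : maxPay A x + α * β = maxPay A z := by rw [hα]; field_simp; ring
  have hgrow := maxPay_growth_of_gap hx hA hβ hcol hrow (α := α) fun w hw hwn =>
    hαβ.trans_le (hmin ⟨hw, hwn⟩)
  have hαt : α < t := by
    by_contra hle
    refine hs ⟨x, hx.1, fun w hw => le_trans ?_ (hgrow w hw)⟩
    have := mul_le_mul_of_nonneg_right (not_lt.1 hle) (norm_nonneg (w - x))
    linarith
  have hα0 : 0 ≤ α := div_nonneg (sub_nonneg.2 (hx.2 z hz)) hβ.le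
  obtain ⟨l, hl⟩ : ∃ l, |z l - x l| = β := by
    by_contra hc
    push Not at hc
    refine absurd hzn (ne_of_lt ((pi_norm_lt_iff hβ).2 fun i => lt_of_le_of_ne ?_ (hc i)))
    exact hzn ▸ norm_le_pi_norm (z - x) i
  obtain ⟨s, hs1, hsz⟩ : ∃ s : ℝ, (s = 1 ∨ s = -1) ∧ s * (z l - x l) = β := by
    rcases abs_cases (z l - x l) with ⟨h, -⟩ | ⟨h, -⟩
    · exact ⟨1, Or.inl rfl, by linarith⟩
    · exact ⟨-1, Or.inr rfl, by linarith⟩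
  refine ⟨l, s, hs1, fun w hw => ?_⟩
  have h1 := hw.2 z hz
  rw [maxPay_rowShift, maxPay_rowShift] at h1
  have h2 := hgrow w hw.1
  have h3 : s * (w l - x l) ≤ ‖w - x‖ := by
    refine le_trans ?_ (norm_le_pi_norm (w - x) l)
    rw [Real.norm_eq_abs, Pi.sub_apply]
    rcases hs1 with rfl | rfl
    · rw [one_mul]; exact le_abs_self _
    · rw [neg_one_mul]; exact neg_le_abs _
  have h4 := mul_le_mul_of_nonneg_left h3 hα0
  -- If `w` moved by less than `β`, its tilted excess over `x` would be at least `(α - t) * (s * (w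
  -- l - x l))`, above the value `(α - t) * β` attained at `z`, because `α < t`.
  by_contra hc
  rw [not_le] at hc
  nlinarith

end Gap

/-! ### Closedness of the relevant sets of games, and counting jumps. -/

section Measurability

lemma rowShift_rowShift {ι κ : Type*} [DecidableEq ι] (l : ι) (a b : ℝ) (A : ι → κ → ℝ) :
    rowShift l a (rowShift l b A) = rowShift l (a + b) A := by
  funext i j
  simp only [rowShift]
  split_ifs <;> ring

variable {ι κ : Type*} [Fintype ι] [Fintype κ] [Nonempty κ]

lemma isClosed_exists_mem_compact {X Y : Type*} [TopologicalSpace X] [TopologicalSpace Y]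
    {K : Set Y} (hK : IsCompact K) {F : Set (X × Y)} (hF : IsClosed F) :
    IsClosed {a | ∃ y ∈ K, (a, y) ∈ F} := by
  have := isCompact_iff_compactSpace.1 hK
  have h := isClosedMap_fst_of_compactSpace (X := X) (Y := K)
  have := h _ (hF.preimage (by fun_prop : Continuous fun p : X × K => (p.1, (p.2 : Y))))
  convert this using 1
  ext a
  simp

lemma isClosed_isOpt : IsClosed {p : (ι → κ → ℝ) × (ι → ℝ) | IsOpt p.1 p.2} := by
  have : {p : (ι → κ → ℝ) × (ι → ℝ) | IsOpt p.1 p.2} =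
      (Prod.snd ⁻¹' stdSimplex ℝ ι) ∩
        ⋂ z ∈ stdSimplex ℝ ι, {p | maxPay p.1 p.2 ≤ maxPay p.1 z} := by
    ext p; simp [IsOpt]
  rw [this]
  refine ((isClosed_stdSimplex ℝ ι).preimage continuous_snd).inter
    (isClosed_biInter fun z _ => isClosed_le continuous_maxPay ?_)
  exact continuous_maxPay.comp (by fun_prop : Continuous fun p : (ι → κ → ℝ) × (ι → ℝ) => (p.1, z))

lemma isClosed_sharp (t : ℝ) : IsClosed {A : ι → κ → ℝ | Sharp t A} := by
  have hF : IsClosed {p : (ι → κ → ℝ) × (ι → ℝ) |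
      ∀ z ∈ stdSimplex ℝ ι, maxPay p.1 p.2 + t * ‖z - p.2‖ ≤ maxPay p.1 z} := by
    have : {p : (ι → κ → ℝ) × (ι → ℝ) |
      ∀ z ∈ stdSimplex ℝ ι, maxPay p.1 p.2 + t * ‖z - p.2‖ ≤ maxPay p.1 z} =
        ⋂ z ∈ stdSimplex ℝ ι, {p | maxPay p.1 p.2 + t * ‖z - p.2‖ ≤ maxPay p.1 z} := by
      ext p; simp
    rw [this]
    refine isClosed_biInter fun z _ => isClosed_le
      (continuous_maxPay.add (by fun_prop)) ?_
    exact continuous_maxPay.comp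
      (by fun_prop : Continuous fun p : (ι → κ → ℝ) × (ι → ℝ) => (p.1, z))
  exact isClosed_exists_mem_compact (isCompact_stdSimplex ℝ ι) hF

lemma isClosed_exists_isOpt {g : (ι → κ → ℝ) × (ι → ℝ) → ℝ} (hg : Continuous g) (a b : ℝ) :
    IsClosed {A : ι → κ → ℝ | ∃ x, IsOpt A x ∧ a ≤ g (A, x) ∧ g (A, x) ≤ b} := by
  have := isClosed_exists_mem_compact (isCompact_stdSimplex ℝ ι)
    (isClosed_isOpt.inter ((isClosed_le continuous_const hg).inter
      (isClosed_le hg continuous_const)) :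
      IsClosed ({p : (ι → κ → ℝ) × (ι → ℝ) | IsOpt p.1 p.2} ∩ ({p | a ≤ g p} ∩ {p | g p ≤ b})))
  convert this using 1
  ext A
  simp only [Set.mem_ofPred_eq, Set.mem_inter_iff]
  exact ⟨fun ⟨x, h1, h2⟩ => ⟨x, h1.1, h1, h2⟩, fun ⟨x, _, h1, h2⟩ => ⟨x, h1, h2⟩⟩

/-- Shifting row `l` by `-(s * τ)` can move coordinate `l` of a minimax strategy by `β` in the
direction `s`. -/
def Jump [DecidableEq ι] (l : ι) (s τ β : ℝ) (A : ι → κ → ℝ) : Prop :=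
  ∃ x w, IsOpt A x ∧ IsOpt (rowShift l (-(s * τ)) A) w ∧ β ≤ s * (w l - x l)

lemma isClosed_jump [DecidableEq ι] (l : ι) (s τ β : ℝ) :
    IsClosed {A : ι → κ → ℝ | Jump l s τ β A} := by
  have hc : Continuous fun p : (ι → κ → ℝ) × ((ι → ℝ) × (ι → ℝ)) =>
      (rowShift l (-(s * τ)) p.1, p.2.2) := by
    unfold rowShift
    fun_prop
  have hc' : Continuous fun p : (ι → κ → ℝ) × ((ι → ℝ) × (ι → ℝ)) => (p.1, p.2.1) := by
    fun_prop
  have := isClosed_exists_mem_compact ((isCompact_stdSimplex ℝ ι).prod (isCompact_stdSimplex ℝ ι))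
    ((isClosed_isOpt.preimage hc').inter ((isClosed_isOpt.preimage hc).inter
      (isClosed_le (continuous_const (y := β)) (by fun_prop :
        Continuous fun p : (ι → κ → ℝ) × ((ι → ℝ) × (ι → ℝ)) => s * (p.2.2 l - p.2.1 l)))))
  convert this using 1
  ext A
  simp only [Set.mem_ofPred_eq, Set.mem_inter_iff, Set.mem_prod, Prod.exists, Jump]
  exact ⟨fun ⟨x, w, h1, h2, h3⟩ => ⟨x, w, ⟨h1.1, h2.1⟩, h1, h2, h3⟩,
    fun ⟨x, w, _, h1, h2, h3⟩ => ⟨x, w, h1, h2, h3⟩⟩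

/-- Along a progression of row shifts, the number of jumps by `β` is at most `1 / β`. -/
lemma card_jump_le [Nonempty ι] [DecidableEq ι] (l : ι) {s τ δ β : ℝ} (hs : s = 1 ∨ s = -1)
    (hτ : τ < δ) (h0 : 0 ≤ τ) (A : ι → κ → ℝ) (K : ℕ) (F : Finset ℕ)
    (hF : ∀ k ∈ F, k < K ∧ Jump l s τ β (rowShift l (-(s * (k * δ))) A)) :
    F.card * β ≤ 1 := by
  classical
  have hss : s * s = 1 := by rcases hs with rfl | rfl <;> norm_num
  have hmono : ∀ {a b : ℝ} {u w : ι → ℝ}, IsOpt (rowShift l (-(s * a)) A) u →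
      IsOpt (rowShift l (-(s * b)) A) w → a < b → s * u l ≤ s * w l := by
    intro a b u w hu hw hab
    have h1 := isOpt_rowShift_mono hu hw
    have h2 : (-(s * a) - -(s * b)) * (w l - u l) = (b - a) * (s * w l - s * u l) := by ring
    rw [h2] at h1
    have := nonneg_of_mul_nonneg_right h1 (sub_pos.2 hab)
    linarith
  have hex : ∀ k : ℕ, ∃ o, IsOpt (rowShift l (-(s * (k * δ))) A) o ∧
      (k ∈ F → ∃ w, IsOpt (rowShift l (-(s * (k * δ + τ))) A) w ∧ β ≤ s * (w l - o l)) := by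
    intro k
    by_cases hk : k ∈ F
    · obtain ⟨x, w, h1, h2, h3⟩ := (hF k hk).2
      rw [rowShift_rowShift] at h2
      refine ⟨x, h1, fun _ => ⟨w, ?_, h3⟩⟩
      convert h2 using 2
      ring
    · obtain ⟨x, hx⟩ := exists_isOpt (rowShift l (-(s * (k * δ))) A)
      exact ⟨x, hx, fun h => (hk h).elim⟩
  choose o ho hoF using hex
  -- A jump starting at `k * δ` is over at `k * δ + τ`, strictly before the next grid point, so
  -- monotonicity carries the gain to `o (k + 1)`. Strictness matters: equal shifts give no
  -- comparison of minimizers.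
  have hstep : ∀ k : ℕ, (if k ∈ F then β else 0) ≤ s * o (k + 1) l - s * o k l := by
    intro k
    split_ifs with hk
    · obtain ⟨w, hw, hwβ⟩ := hoF k hk
      have := hmono hw (ho (k + 1)) (by push_cast; linarith)
      linarith
    · have := hmono (ho k) (ho (k + 1)) (by push_cast; nlinarith)
      linarith
  have hsum := Finset.sum_le_sum fun k (_ : k ∈ Finset.range K) => hstep k
  rw [Finset.sum_range_sub (fun k => s * o k l), Finset.sum_ite_mem] at hsum
  have hFK : Finset.range K ∩ F = F :=
    Finset.inter_eq_right.2 fun k hk => Finset.mem_range.2 (hF k hk).1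
  rw [hFK, Finset.sum_const, nsmul_eq_mul] at hsum
  have hb : ∀ k, 0 ≤ o k l ∧ o k l ≤ 1 := fun k =>
    ⟨(ho k).1.1 l, (mem_Icc_of_mem_stdSimplex (ho k).1 l).2⟩
  have hbK := hb K
  have hb0 := hb 0
  rcases hs with rfl | rfl <;> linarith

end Measurability

/-! ### Gaussian densities under small volume preserving displacements. -/

section Density

open scoped ENNReal NNReal

lemma lintegral_fin_prod_eq_prod_lintegral {n : ℕ} {E : Fin n → Type*}
    {mE : ∀ i, MeasurableSpace (E i)} {μ : (i : Fin n) → Measure (E i)} [∀ i, SigmaFinite (μ i)]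
    {f : (i : Fin n) → E i → ℝ≥0∞} (hf : ∀ i, Measurable (f i)) :
    ∫⁻ x : (i : Fin n) → E i, ∏ i, f i (x i) ∂(Measure.pi μ) = ∏ i, ∫⁻ x, f i x ∂(μ i) := by
  induction n with
  | zero => simp
  | succ n n_ih =>
      calc
        _ = ∫⁻ x : E 0 × ((i : Fin n) → E (Fin.succ i)),
            f 0 x.1 * ∏ i : Fin n, f (Fin.succ i) (x.2 i)
            ∂((μ 0).prod (Measure.pi (fun i ↦ μ i.succ))) := by
          rw [← ((measurePreserving_piFinSuccAbove μ 0).symm).lintegral_comp_emb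
            (MeasurableEquiv.measurableEmbedding _)]
          simp_rw [MeasurableEquiv.piFinSuccAbove_symm_apply, Fin.insertNthEquiv,
            Fin.prod_univ_succ, Equiv.coe_fn_mk, Fin.insertNth_zero, Fin.cons_succ, Fin.cons_zero]
          rfl
        _ = (∫⁻ x, f 0 x ∂μ 0)
            * ∏ i : Fin n, ∫⁻ (x : E (Fin.succ i)), f (Fin.succ i) x ∂(μ i.succ) := by
          rw [← n_ih fun i => hf _]
          exact lintegral_prod_mul (hf 0).aemeasurable
            (Finset.measurable_prod _ fun i _ =>
              (hf _).comp (measurable_pi_apply i)).aemeasurable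
        _ = ∏ i, ∫⁻ x, f i x ∂(μ i) := by rw [Fin.prod_univ_succ]

lemma lintegral_fintype_prod_eq_prod_lintegral {ι : Type*} [Fintype ι] {E : ι → Type*}
    {mE : ∀ i, MeasurableSpace (E i)} {μ : (i : ι) → Measure (E i)} [∀ i, SigmaFinite (μ i)]
    {f : (i : ι) → E i → ℝ≥0∞} (hf : ∀ i, Measurable (f i)) :
    ∫⁻ x : (i : ι) → E i, ∏ i, f i (x i) ∂(Measure.pi μ) = ∏ i, ∫⁻ x, f i x ∂(μ i) := by
  let e := (Fintype.equivFin ι).symm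
  rw [← (measurePreserving_piCongrLeft _ e).lintegral_comp_emb
    (MeasurableEquiv.measurableEmbedding _)]
  simp_rw [← e.prod_comp, MeasurableEquiv.coe_piCongrLeft, Equiv.piCongrLeft_apply_apply]
  exact lintegral_fin_prod_eq_prod_lintegral fun i => hf _

lemma pi_withDensity {ι : Type*} [Fintype ι] {E : ι → Type*}
    {mE : ∀ i, MeasurableSpace (E i)} {μ : (i : ι) → Measure (E i)} [∀ i, SigmaFinite (μ i)]
    {f : (i : ι) → E i → ℝ≥0∞} (hf : ∀ i, Measurable (f i))
    [∀ i, SigmaFinite ((μ i).withDensity (f i))] :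
    Measure.pi (fun i => (μ i).withDensity (f i)) =
      (Measure.pi μ).withDensity fun x => ∏ i, f i (x i) := by
  refine Measure.pi_eq fun s hs => ?_
  rw [withDensity_apply _ (MeasurableSet.univ_pi hs),
    ← lintegral_indicator (MeasurableSet.univ_pi hs)]
  have : ∀ x, (Set.univ.pi s).indicator (fun x => ∏ i, f i (x i)) x
      = ∏ i, (s i).indicator (f i) (x i) := by
    intro x
    by_cases hx : x ∈ Set.univ.pi s
    · rw [Set.indicator_of_mem hx]
      exact Finset.prod_congr rfl fun i _ =>
        (Set.indicator_of_mem (hx i (Set.mem_univ i)) _).symm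
    · rw [Set.indicator_of_notMem hx]
      obtain ⟨i, hi⟩ : ∃ i, x i ∉ s i := by simpa using hx
      exact (Finset.prod_eq_zero (Finset.mem_univ i) (Set.indicator_of_notMem hi _)).symm
  simp_rw [this]
  rw [lintegral_fintype_prod_eq_prod_lintegral fun i => (hf i).indicator (hs i)]
  refine Finset.prod_congr rfl fun i _ => ?_
  rw [withDensity_apply _ (hs i), lintegral_indicator (hs i)]

variable {ι κ : Type*} [Fintype ι] [Fintype κ]

/-- The law of an array of independent Gaussians with means `a` and variance `v`. -/
noncomputable def gaussLaw (a : ι → κ → ℝ) (v : ℝ≥0) : Measure (ι → κ → ℝ) :=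
  Measure.pi fun i => Measure.pi fun j => gaussianReal (a i j) v

/-- The density of `gaussLaw`. -/
noncomputable def gaussDensity (a : ι → κ → ℝ) (v : ℝ≥0) (A : ι → κ → ℝ) : ℝ≥0∞ :=
  ∏ i, ∏ j, gaussianPDF (a i j) v (A i j)

instance (a : ι → κ → ℝ) (v : ℝ≥0) : IsProbabilityMeasure (gaussLaw a v) := by
  unfold gaussLaw; infer_instance

lemma measurable_gaussDensity (a : ι → κ → ℝ) (v : ℝ≥0) : Measurable (gaussDensity a v) := by
  unfold gaussDensity
  refine Finset.measurable_prod _ fun i _ => Finset.measurable_prod _ fun j _ => ?_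
  exact (measurable_gaussianPDF _ _).comp
    ((measurable_pi_apply j).comp (measurable_pi_apply i))

lemma gaussLaw_eq_withDensity (a : ι → κ → ℝ) {v : ℝ≥0} (hv : v ≠ 0) :
    gaussLaw a v = volume.withDensity (gaussDensity a v) := by
  have h1 : ∀ i j, gaussianReal (a i j) v = volume.withDensity (gaussianPDF (a i j) v) :=
    fun i j => gaussianReal_of_var_ne_zero _ hv
  have i1 : ∀ i j, SigmaFinite ((volume : Measure ℝ).withDensity (gaussianPDF (a i j) v)) :=
    fun i j => h1 i j ▸ inferInstance
  have h2 : ∀ i, Measure.pi (fun j => gaussianReal (a i j) v) =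
      (volume : Measure (κ → ℝ)).withDensity fun y => ∏ j, gaussianPDF (a i j) v (y j) := by
    intro i
    have := i1 i
    simp_rw [h1]
    exact pi_withDensity fun j => measurable_gaussianPDF _ _
  have i2 : ∀ i, SigmaFinite ((volume : Measure (κ → ℝ)).withDensity
      fun y => ∏ j, gaussianPDF (a i j) v (y j)) := fun i => h2 i ▸ inferInstance
  unfold gaussLaw
  simp_rw [h2]
  exact pi_withDensity fun i => Finset.measurable_prod _ fun j _ =>
    (measurable_gaussianPDF _ _).comp (measurable_pi_apply j)

lemma gaussianPDFReal_le_exp_mul {m x y b ω : ℝ} {v : ℝ≥0} (hv : v ≠ 0) (hx : |x - m| ≤ b)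
    (hxy : |y - x| ≤ ω) :
    gaussianPDFReal m v x ≤ Real.exp ((2 * b * ω + ω ^ 2) / (2 * v)) * gaussianPDFReal m v y := by
  have hv' : (0 : ℝ) < v := by positivity
  rw [gaussianPDFReal, gaussianPDFReal, mul_left_comm, ← Real.exp_add]
  gcongr
  rw [← add_div]
  gcongr
  have h1 : |(x - m) * (y - x)| ≤ b * ω := by
    rw [abs_mul]
    exact mul_le_mul hx hxy (abs_nonneg _) ((abs_nonneg _).trans hx)
  have h2 : (y - x) ^ 2 ≤ ω ^ 2 := sq_le_sq' (by linarith [(abs_le.1 hxy).1]) (abs_le.1 hxy).2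
  have h3 := (abs_le.1 h1).2
  nlinarith

lemma gaussDensity_le {a A B : ι → κ → ℝ} {v : ℝ≥0} (hv : v ≠ 0) {R ω : ℝ}
    (ha : ∀ i j, |a i j| ≤ 1) (hA : ∀ i j, |A i j| ≤ R) (hAB : ∀ i j, |B i j - A i j| ≤ ω)
    (h1 : ω ≤ 1) (hω : Fintype.card ι * Fintype.card κ * ((2 * R + 3) * ω) ≤ 2 * v) :
    gaussDensity a v A ≤ 3 * gaussDensity a v B := by
  have hv' : (0 : ℝ) < v := by positivity
  rcases isEmpty_or_nonempty ι with hι | ⟨⟨i₀⟩⟩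
  · simp only [gaussDensity, Finset.univ_eq_empty, Finset.prod_empty]; norm_num
  rcases isEmpty_or_nonempty κ with hκ | ⟨⟨j₀⟩⟩
  · simp only [gaussDensity, Finset.univ_eq_empty, Finset.prod_empty, Finset.prod_const_one]
    norm_num
  have hω0 : 0 ≤ ω := (abs_nonneg _).trans (hAB i₀ j₀)
  set E := (2 * (R + 1) * ω + ω ^ 2) / (2 * v) with hE
  have hpt : ∀ i j, gaussianPDF (a i j) v (A i j) ≤
      ENNReal.ofReal (Real.exp E) * gaussianPDF (a i j) v (B i j) := by
    intro i j
    rw [gaussianPDF, gaussianPDF, ← ENNReal.ofReal_mul (Real.exp_pos _).le]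
    refine ENNReal.ofReal_le_ofReal (gaussianPDFReal_le_exp_mul hv ?_ (hAB i j))
    exact (abs_sub _ _).trans (add_le_add (hA i j) (ha i j))
  calc gaussDensity a v A
      ≤ ∏ i, ∏ j, (ENNReal.ofReal (Real.exp E) * gaussianPDF (a i j) v (B i j)) :=
        Finset.prod_le_prod' fun i _ => Finset.prod_le_prod' fun j _ => hpt i j
    _ = ENNReal.ofReal (Real.exp (Fintype.card ι * Fintype.card κ * E)) * gaussDensity a v B := by
        simp only [Finset.prod_mul_distrib, Finset.prod_const, Finset.card_univ, gaussDensity]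
        rw [← pow_mul, ← ENNReal.ofReal_pow (Real.exp_pos _).le, ← Real.exp_nat_mul]
        congr 4
        push_cast; ring
    _ ≤ 3 * gaussDensity a v B := by
        gcongr
        have hle : Fintype.card ι * Fintype.card κ * E ≤ 1 := by
          rw [hE, mul_div_assoc', div_le_one (by positivity)]
          refine le_trans (mul_le_mul_of_nonneg_left ?_ (by positivity)) hω
          nlinarith
        have h3 : Real.exp (Fintype.card ι * Fintype.card κ * E) ≤ 3 :=
          (Real.exp_le_exp.2 hle).trans (by linarith [Real.exp_one_lt_d9])
        exact (ENNReal.ofReal_le_ofReal h3).trans (by simp)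

/-- A small volume preserving displacement of a set of bounded arrays costs a bounded factor. -/
lemma gaussLaw_le_of_displacement {a : ι → κ → ℝ} {v : ℝ≥0} (hv : v ≠ 0) {R ω : ℝ}
    (ha : ∀ i j, |a i j| ≤ 1) (h1 : ω ≤ 1)
    (hω : Fintype.card ι * Fintype.card κ * ((2 * R + 3) * ω) ≤ 2 * v)
    {T : (ι → κ → ℝ) → (ι → κ → ℝ)} (hT : MeasurePreserving T volume volume)
    {S V : Set (ι → κ → ℝ)} (hV : MeasurableSet V)
    (hS : ∀ A ∈ S, (∀ i j, |A i j| ≤ R) ∧ (∀ i j, |T A i j - A i j| ≤ ω) ∧ T A ∈ V) :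
    gaussLaw a v S ≤ 3 * gaussLaw a v V := by
  have hρ := measurable_gaussDensity a v
  -- `S` need not be measurable, so it is enlarged to a measurable set on which the density
  -- comparison still holds.
  have hm : MeasurableSet (T ⁻¹' V ∩ {A | gaussDensity a v A ≤ 3 * gaussDensity a v (T A)}) :=
    (hT.measurable hV).inter (measurableSet_le hρ ((hρ.comp hT.measurable).const_mul _))
  calc gaussLaw a v S
      ≤ gaussLaw a v (T ⁻¹' V ∩ {A | gaussDensity a v A ≤ 3 * gaussDensity a v (T A)}) :=
        measure_mono fun A hA =>
          ⟨(hS A hA).2.2, gaussDensity_le hv ha (hS A hA).1 (hS A hA).2.1 h1 hω⟩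
    _ = ∫⁻ A in T ⁻¹' V ∩ {A | gaussDensity a v A ≤ 3 * gaussDensity a v (T A)},
          gaussDensity a v A := by
        rw [gaussLaw_eq_withDensity a hv, withDensity_apply _ hm]
    _ ≤ ∫⁻ A in T ⁻¹' V ∩ {A | gaussDensity a v A ≤ 3 * gaussDensity a v (T A)},
          3 * gaussDensity a v (T A) :=
        setLIntegral_mono' hm fun A hA => hA.2
    _ ≤ ∫⁻ A in T ⁻¹' V, 3 * gaussDensity a v (T A) :=
        lintegral_mono_set Set.inter_subset_left
    _ = 3 * gaussLaw a v V := by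
        rw [lintegral_const_mul _ (show Measurable fun A => gaussDensity a v (T A) from
          hρ.comp hT.measurable), hT.setLIntegral_comp_preimage hV hρ,
          gaussLaw_eq_withDensity a hv, withDensity_apply _ hV]

lemma measurePreserving_rowShift [DecidableEq ι] (l : ι) (c : ℝ) :
    MeasurePreserving (rowShift l c : (ι → κ → ℝ) → (ι → κ → ℝ)) volume volume :=
  measurePreserving_add_right volume (fun i _ => if i = l then c else 0)

lemma measurePreserving_colShift [DecidableEq κ] (j : κ) (c : ℝ) :
    MeasurePreserving (colShift j c : (ι → κ → ℝ) → (ι → κ → ℝ)) volume volume :=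
  measurePreserving_add_right volume (fun _ k => if k = j then c else 0)

/-- `shear` as a linear map. -/
def shearLin (r l : ι) (c : ℝ) : (ι → κ → ℝ) →ₗ[ℝ] (ι → κ → ℝ) where
  toFun := shear r l c
  map_add' A B := by funext i j; simp [shear]; ring
  map_smul' t A := by funext i j; simp [shear]; ring

/-- Exchanging rows `r` and `l` conjugates the shear to the one with `-c`, which is its inverse;
hence the square of the determinant is one. -/
lemma abs_det_shearLin {ι κ : Type*} (r l : ι) (c : ℝ) :
    |LinearMap.det (shearLin r l c : (ι → κ → ℝ) →ₗ[ℝ] _)| = 1 := by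
  classical
  let e : (ι → κ → ℝ) ≃ₗ[ℝ] (ι → κ → ℝ) := LinearEquiv.funCongrLeft ℝ (κ → ℝ) (Equiv.swap r l)
  have hinv : (shearLin r l c : (ι → κ → ℝ) →ₗ[ℝ] _) ∘ₗ shearLin r l (-c) = LinearMap.id := by
    refine LinearMap.ext fun A => ?_
    funext i j
    simp [shearLin, shear]
  have hconj : (e : (ι → κ → ℝ) →ₗ[ℝ] _) ∘ₗ shearLin r l c ∘ₗ (e.symm : (ι → κ → ℝ) →ₗ[ℝ] _)
      = shearLin r l (-c) := by
    refine LinearMap.ext fun A => ?_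
    funext i j
    simp [shearLin, shear, e, LinearEquiv.funCongrLeft, LinearMap.funLeft]
    ring
  have h1 := LinearMap.det_conj (shearLin r l c : (ι → κ → ℝ) →ₗ[ℝ] _) e
  rw [hconj] at h1
  have h2 := congrArg LinearMap.det hinv
  rw [LinearMap.det_comp, h1, LinearMap.det_id] at h2
  have h3 : |LinearMap.det (shearLin r l c : (ι → κ → ℝ) →ₗ[ℝ] _)| ^ 2 = 1 := by
    rw [sq_abs, sq, h2]
  nlinarith [abs_nonneg (LinearMap.det (shearLin r l c : (ι → κ → ℝ) →ₗ[ℝ] _))]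

lemma measurePreserving_shear (r l : ι) (c : ℝ) :
    MeasurePreserving (shear r l c : (ι → κ → ℝ) → (ι → κ → ℝ)) volume volume := by
  have hdet := abs_det_shearLin (κ := κ) r l c
  have hne : LinearMap.det (shearLin r l c : (ι → κ → ℝ) →ₗ[ℝ] _) ≠ 0 := by
    intro h; rw [h] at hdet; simp at hdet
  refine ⟨(LinearMap.continuous_of_finiteDimensional (shearLin r l c)).measurable, ?_⟩
  have h := Measure.map_linearMap_addHaar_eq_smul_addHaar
    (volume : Measure (ι → κ → ℝ)) hne
  rw [abs_inv, hdet] at h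
  rw [inv_one, ENNReal.ofReal_one, one_smul] at h
  exact h

end Density

/-! ### Probability bounds for jumps, small slacks and small coordinates. -/

section Bounds

open scoped ENNReal NNReal

variable {ι κ : Type*} [Fintype ι] [Fintype κ] [Nonempty κ] [Nonempty ι]

/-- The event is displaced along `K` row shifts, each costing a factor 3, and every game lies in at
most `1 / β` of the displaced jump sets. -/
lemma gaussLaw_jump_le [DecidableEq ι] {a : ι → κ → ℝ} {v : ℝ≥0} (hv : v ≠ 0)
    (ha : ∀ i j, |a i j| ≤ 1) (l : ι) {s τ δ β R : ℝ} (hs : s = 1 ∨ s = -1) (h0 : 0 ≤ τ)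
    (hτ : τ < δ) (hβ : 0 < β) (K : ℕ) (h1 : K * δ ≤ 1)
    (hω : Fintype.card ι * Fintype.card κ * ((2 * R + 3) * (K * δ)) ≤ 2 * v) :
    K * gaussLaw a v {A | Jump l s τ β A ∧ ∀ i j, |A i j| ≤ R} ≤ ENNReal.ofReal (3 / β) := by
  classical
  set V : ℕ → Set (ι → κ → ℝ) := fun k => {A | Jump l s τ β (rowShift l (-(s * (k * δ))) A)}
    with hVdef
  have hVm : ∀ k, MeasurableSet (V k) := fun k =>
    (isClosed_jump l s τ β).measurableSet.preimage (measurePreserving_rowShift l _).measurable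
  have hk : ∀ k ∈ Finset.range K, gaussLaw a v {A | Jump l s τ β A ∧ ∀ i j, |A i j| ≤ R}
      ≤ 3 * gaussLaw a v (V k) := by
    intro k hk
    refine gaussLaw_le_of_displacement hv ha h1 hω
      (measurePreserving_rowShift l (s * (k * δ))) (hVm k) fun A hA => ⟨hA.2, fun i j => ?_, ?_⟩
    · have hkK : (k : ℝ) ≤ K := by exact_mod_cast (Finset.mem_range.1 hk).le
      have hδ : 0 < δ := h0.trans_lt hτ
      have h2 : (k : ℝ) * δ ≤ K * δ := by gcongr
      have h3 : 0 ≤ (k : ℝ) * δ := by positivity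
      simp only [rowShift, add_sub_cancel_left]
      split_ifs
      · rcases hs with rfl | rfl
        · rw [one_mul, abs_of_nonneg h3]; exact h2
        · rw [neg_one_mul, abs_neg, abs_of_nonneg h3]; exact h2
      · rw [abs_zero]; exact h3.trans h2
    · change Jump l s τ β (rowShift l (-(s * (k * δ))) (rowShift l (s * (k * δ)) A))
      rw [rowShift_rowShift, neg_add_cancel]
      have : rowShift l 0 A = A := by funext i j; simp [rowShift]
      rw [this]
      exact hA.1
  have hpt : ∀ A, ∑ k ∈ Finset.range K, (V k).indicator (1 : (ι → κ → ℝ) → ℝ≥0∞) A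
      ≤ ENNReal.ofReal (1 / β) := by
    intro A
    have hcard := card_jump_le l hs hτ h0 A (β := β) K ((Finset.range K).filter fun k => A ∈ V k)
      fun k hk => ⟨Finset.mem_range.1 (Finset.mem_filter.1 hk).1, (Finset.mem_filter.1 hk).2⟩
    have : ∑ k ∈ Finset.range K, (V k).indicator (1 : (ι → κ → ℝ) → ℝ≥0∞) A
        = (((Finset.range K).filter fun k => A ∈ V k).card : ℝ≥0∞) := by
      simp only [Set.indicator_apply, Pi.one_apply, Finset.sum_boole]
    rw [this, ← ENNReal.ofReal_natCast]
    exact ENNReal.ofReal_le_ofReal ((le_div_iff₀ hβ).2 hcard)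
  calc K * gaussLaw a v {A | Jump l s τ β A ∧ ∀ i j, |A i j| ≤ R}
      = ∑ _k ∈ Finset.range K, gaussLaw a v {A | Jump l s τ β A ∧ ∀ i j, |A i j| ≤ R} := by simp
    _ ≤ ∑ k ∈ Finset.range K, 3 * gaussLaw a v (V k) := Finset.sum_le_sum hk
    _ = 3 * ∫⁻ A, ∑ k ∈ Finset.range K, (V k).indicator 1 A ∂gaussLaw a v := by
        rw [lintegral_finsetSum _ fun k _ => measurable_one.indicator (hVm k), Finset.mul_sum]
        simp_rw [lintegral_indicator_one (hVm _)]
    _ ≤ 3 * ∫⁻ _A, ENNReal.ofReal (1 / β) ∂gaussLaw a v := by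
        gcongr with A
        exact hpt A
    _ = ENNReal.ofReal (3 / β) := by
        rw [lintegral_const, measure_univ, mul_one, ← ENNReal.ofReal_ofNat,
          ← ENNReal.ofReal_mul (by norm_num)]
        congr 1
        ring

/-- Two minimizers form a jump under the zero shift `τ = 0`. The spacing of the shifts is then free,
so `K` can be arbitrarily large in the jump bound. -/
lemma gaussLaw_not_unique {a : ι → κ → ℝ} {v : ℝ≥0} (hv : v ≠ 0) (ha : ∀ i j, |a i j| ≤ 1) :
    gaussLaw a v {A | ∃ x w, IsOpt A x ∧ IsOpt A w ∧ x ≠ w} = 0 := by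
  classical
  have hv' : (0 : ℝ) < v := by positivity
  have hsub : {A : ι → κ → ℝ | ∃ x w, IsOpt A x ∧ IsOpt A w ∧ x ≠ w} ⊆
      ⋃ (l : ι) (N : ℕ) (R : ℕ), {A | Jump l 1 0 (1 / (N + 1 : ℝ)) A ∧ ∀ i j, |A i j| ≤ R} := by
    rintro A ⟨x, w, hx, hw, hne⟩
    obtain ⟨l, hl⟩ : ∃ l, x l ≠ w l := by
      by_contra h
      push Not at h
      exact hne (funext h)
    have hR : ∃ R : ℕ, ∀ i j, |A i j| ≤ R := by
      obtain ⟨R, hR⟩ := exists_nat_ge ‖A‖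
      exact ⟨R, fun i j => ((norm_le_pi_norm (A i) j).trans (norm_le_pi_norm A i)).trans hR⟩
    obtain ⟨R, hR⟩ := hR
    have key : ∀ x w, IsOpt A x → IsOpt A w → x l < w l → A ∈ ⋃ (l : ι) (N : ℕ) (R : ℕ),
        {A | Jump l 1 0 (1 / (N + 1 : ℝ)) A ∧ ∀ i j, |A i j| ≤ R} := by
      intro x w hx hw hlt
      obtain ⟨N, hN⟩ := exists_nat_one_div_lt (sub_pos.2 hlt)
      simp only [Set.mem_iUnion]
      refine ⟨l, N, R, ⟨x, w, hx, ?_, by rw [one_mul]; exact hN.le⟩, hR⟩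
      have : rowShift l (-(1 * 0)) A = A := by funext i j; simp [rowShift]
      rwa [this]
    rcases lt_or_gt_of_ne hl with h | h
    · exact key x w hx hw h
    · exact key w x hw hx h
  refine measure_mono_null hsub (measure_iUnion_null fun l => measure_iUnion_null fun N =>
    measure_iUnion_null fun R => ?_)
  by_contra hne
  obtain ⟨K, hK⟩ := ENNReal.exists_nat_mul_gt hne
    (ENNReal.ofReal_ne_top (r := 3 / (1 / (N + 1 : ℝ))))
  set D : ℝ := (K + 1) * (1 + Fintype.card ι * Fintype.card κ * (2 * R + 3) / (2 * v)) with hD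
  have hDpos : 0 < D := by positivity
  have hKD : K * (1 / D) * (1 + Fintype.card ι * Fintype.card κ * (2 * R + 3) / (2 * v)) ≤ 1 := by
    rw [mul_one_div, div_mul_eq_mul_div, div_le_one hDpos, hD]
    gcongr
    linarith
  have hq : 0 ≤ Fintype.card ι * Fintype.card κ * (2 * (R : ℝ) + 3) / (2 * v) := by positivity
  have hKD0 : 0 ≤ K * (1 / D) := by positivity
  refine absurd hK (not_lt.2 (gaussLaw_jump_le hv ha l (Or.inl rfl) le_rfl (one_div_pos.2 hDpos)
    (by positivity) K ?_ ?_))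
  · nlinarith
  · have : K * (1 / D) * (Fintype.card ι * Fintype.card κ * (2 * (R : ℝ) + 3) / (2 * v)) ≤ 1 := by
      nlinarith
    rw [mul_div_assoc', div_le_one (by positivity)] at this
    linarith

/-- If a continuous functional of the minimax strategy is small on `S`, and `S` can be displaced so
that the functional grows in steps, then `S` is a small part of the non sharp games. -/
lemma gaussLaw_slice_le {a : ι → κ → ℝ} {v : ℝ≥0} (hv : v ≠ 0)
    (ha : ∀ i j, |a i j| ≤ 1) {t γ R ω : ℝ} (hγ : 0 < γ) (K : ℕ) (h1 : ω ≤ 1)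
    (hω : Fintype.card ι * Fintype.card κ * ((2 * R + 3) * ω) ≤ 2 * v)
    {g : (ι → κ → ℝ) × (ι → ℝ) → ℝ} (hg : Continuous g) {S : Set (ι → κ → ℝ)}
    {T : ℕ → (ι → κ → ℝ) → (ι → κ → ℝ)} (hT : ∀ k, MeasurePreserving (T k) volume volume)
    (hS : ∀ A ∈ S, (∀ i j, |A i j| ≤ R) ∧ ∀ k < K, (∀ i j, |T k A i j - A i j| ≤ ω) ∧
      ¬ Sharp t (T k A) ∧
      ∃ x, IsOpt (T k A) x ∧ 2 * k * γ ≤ g (T k A, x) ∧ g (T k A, x) ≤ (2 * k + 1) * γ) :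
    K * gaussLaw a v S ≤ 3 * gaussLaw a v {A | ¬ Sharp t A} := by
  set V : ℕ → Set (ι → κ → ℝ) := fun k =>
    {A | ∃ x, IsOpt A x ∧ 2 * k * γ ≤ g (A, x) ∧ g (A, x) ≤ (2 * k + 1) * γ} ∩
      {A | Sharp t A}ᶜ with hV
  have hVm : ∀ k, MeasurableSet (V k) := fun k =>
    (isClosed_exists_isOpt hg _ _).measurableSet.inter (isClosed_sharp t).measurableSet.compl
  -- The value intervals have length `γ` and spacing `2 * γ`, so a game in two slices has two
  -- distinct minimizers.
  have hlt : ∀ j k : ℕ, j < k → V j ∩ V k ⊆ {A | ∃ x w, IsOpt A x ∧ IsOpt A w ∧ x ≠ w} := by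
    rintro j k hjk A ⟨⟨⟨x, hx, -, hx2⟩, -⟩, ⟨⟨w, hw, hw1, -⟩, -⟩⟩
    refine ⟨x, w, hx, hw, ?_⟩
    rintro rfl
    have : (j : ℝ) + 1 ≤ k := by exact_mod_cast hjk
    nlinarith
  have hdisj : Pairwise fun j k => AEDisjoint (gaussLaw a v) (V j) (V k) := by
    intro j k hjk
    refine measure_mono_null ?_ (gaussLaw_not_unique hv ha)
    rcases lt_or_gt_of_ne hjk with h | h
    · exact hlt j k h
    · rw [Set.inter_comm]; exact hlt k j h
  calc K * gaussLaw a v S = ∑ _k ∈ Finset.range K, gaussLaw a v S := by simp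
    _ ≤ ∑ k ∈ Finset.range K, 3 * gaussLaw a v (V k) := Finset.sum_le_sum fun k hk =>
        gaussLaw_le_of_displacement hv ha h1 hω (hT k) (hVm k) fun A hA => by
          obtain ⟨hR, h⟩ := hS A hA
          obtain ⟨h1, h2, h3⟩ := h k (Finset.mem_range.1 hk)
          exact ⟨hR, h1, h3, h2⟩
    _ = 3 * gaussLaw a v (⋃ k ∈ Finset.range K, V k) := by
        rw [← Finset.mul_sum, measure_biUnion_finset₀ (fun j _ k _ h => hdisj h)
          fun k _ => (hVm k).nullMeasurableSet]
    _ ≤ 3 * gaussLaw a v {A | ¬ Sharp t A} := by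
        gcongr
        exact Set.iUnion₂_subset fun k _ A hA => hA.2

lemma gaussLaw_small_slack_le [DecidableEq κ] {a : ι → κ → ℝ} {v : ℝ≥0} (hv : v ≠ 0)
    (ha : ∀ i j, |a i j| ≤ 1) (j : κ) {t γ R : ℝ} (ht : 0 ≤ t) (hγ : 0 < γ) (K : ℕ)
    (h1 : 2 * K * γ ≤ 1)
    (hω : Fintype.card ι * Fintype.card κ * ((2 * R + 3) * (2 * K * γ)) ≤ 2 * v) :
    K * gaussLaw a v {A | (∀ i j, |A i j| ≤ R) ∧ ¬ Sharp t A ∧ ∃ x, IsStrictOpt A x ∧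
      0 < maxPay A x - colPay A x j ∧ maxPay A x - colPay A x j ≤ γ} ≤
      3 * gaussLaw a v {A | ¬ Sharp t A} := by
  refine gaussLaw_slice_le hv ha hγ K h1 hω (g := fun p => maxPay p.1 p.2 - colPay p.1 p.2 j)
    (continuous_maxPay.sub (by unfold colPay; fun_prop))
    (T := fun k => colShift j (-(2 * k * γ))) (fun k => measurePreserving_colShift j _) ?_
  rintro A ⟨hR, hs, x, hx, hx0, hxγ⟩
  refine ⟨hR, fun k hk => ?_⟩
  have hk0 : 0 ≤ 2 * k * γ := by positivity
  have hkK : (k : ℝ) ≤ K := by exact_mod_cast hk.le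
  have hc : -(2 * k * γ) ≤ 0 := by linarith
  have hj := sub_pos.1 hx0
  refine ⟨fun i k' => ?_, fun h => hs (hx.sharp_of_colShift ht hc hj h), x,
    (hx.colShift hc hj).isOpt, ?_⟩
  · have h2 : 2 * k * γ ≤ 2 * K * γ := by gcongr
    simp only [colShift, add_sub_cancel_left]
    split_ifs
    · rw [abs_neg, abs_of_nonneg hk0]; exact h2
    · rw [abs_zero]; exact hk0.trans h2
  · simp only [maxPay_colShift_eq hx.1.2 hc hj, colPay_colShift hx.1.2, if_true]
    constructor <;> linarith

lemma gaussLaw_small_coord_le [DecidableEq ι] {a : ι → κ → ℝ} {v : ℝ≥0} (hv : v ≠ 0)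
    (ha : ∀ i j, |a i j| ≤ 1) {r l : ι} (hrl : r ≠ l) {t γ R : ℝ} (ht : 0 ≤ t) (hγ : 0 < γ)
    (K : ℕ) (h1 : 4 * R * K * γ ≤ 1)
    (hω : Fintype.card ι * Fintype.card κ * ((2 * R + 3) * (4 * R * K * γ)) ≤ 2 * v) :
    K * gaussLaw a v {A | (∀ i j, |A i j| ≤ R) ∧ ¬ Sharp t A ∧ ∃ x, IsStrictOpt A x ∧
      0 < x r ∧ x r ≤ γ ∧ 2 * K * γ < x l} ≤
      3 * gaussLaw a v {A | ¬ Sharp t A} := by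
  refine gaussLaw_slice_le hv ha hγ K h1 hω (g := fun p => p.2 r) (by fun_prop)
    (T := fun k => shear r l (2 * k * γ)) (fun k => measurePreserving_shear r l _) ?_
  rintro A ⟨hR, hs, x, hx, hx0, hxγ, hxl⟩
  refine ⟨hR, fun k hk => ?_⟩
  have hk0 : 0 ≤ 2 * k * γ := by positivity
  have hkK : (k : ℝ) ≤ K := by exact_mod_cast hk.le
  have h2 : 2 * k * γ ≤ 2 * K * γ := by gcongr
  have hl := h2.trans_lt hxl
  refine ⟨fun i j => ?_, fun h => hs (hx.sharp_of_shear hrl ht hk0 hx0 hl h), _,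
    (hx.shear hrl hk0 hx0 hl).isOpt, ?_⟩
  · have h3 : |A r j - A l j| ≤ 2 * R := by
      rw [abs_le]
      have := abs_le.1 (hR r j)
      have := abs_le.1 (hR l j)
      constructor <;> linarith
    have h4 : shear r l (2 * k * γ) A i j - A i j = -(2 * k * γ * (A r j - A l j)) := by
      simp only [shear]; ring
    rw [h4, abs_neg, abs_mul, abs_of_nonneg hk0]
    calc 2 * k * γ * |A r j - A l j| ≤ 2 * K * γ * (2 * R) := by gcongr
      _ = 4 * R * K * γ := by ring
  · simp only [Pi.add_apply, Pi.smul_apply, Pi.sub_apply, Pi.single_eq_same, smul_eq_mul,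
      Pi.single_eq_of_ne hrl, sub_zero, mul_one]
    constructor <;> linarith

/-- Games are sharp unless an entry is large or a minimax strategy jumps. -/
lemma gaussLaw_not_sharp_le {a : ι → κ → ℝ} {v : ℝ≥0} (hv : v ≠ 0) (hv1 : v ≤ 1)
    (ha : ∀ i j, |a i j| ≤ 1) {t β R : ℝ} (ht : 0 < t) (hβ : 0 < β) (hR : 1 ≤ R) (K : ℕ)
    (hK : 0 < K)
    (hωβ : Fintype.card ι * Fintype.card κ * ((2 * R + 3) * (4 * Fintype.card ι * R *
      (6 * (Fintype.card κ + Fintype.card ι ^ 2)) * β)) ≤ 2 * v)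
    (hωt : Fintype.card ι * Fintype.card κ * ((2 * R + 3) * (K * (2 * t))) ≤ 2 * v) :
    (gaussLaw a v).real {A | ¬ Sharp t A} ≤
      2 * (gaussLaw a v).real {A | ∀ i j, |A i j| ≤ R}ᶜ + 12 * Fintype.card ι / (β * K) := by
  classical
  set μ := gaussLaw a v with hμ
  set n : ℝ := (Fintype.card ι : ℝ) with hn
  set m : ℝ := (Fintype.card κ : ℝ) with hm
  have hn1 : 1 ≤ n := by rw [hn]; exact_mod_cast Fintype.card_pos
  have hm1 : 1 ≤ m := by rw [hm]; exact_mod_cast Fintype.card_pos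
  have hnm : 1 ≤ n * m := by nlinarith
  have hv1' : (v : ℝ) ≤ 1 := by exact_mod_cast hv1
  -- One event per column and one per pair of rows, each at most `3 * P / L`, then sum to `P / 2`.
  set L : ℕ := 6 * (Fintype.card κ + Fintype.card ι ^ 2) with hL
  have hLr : (L : ℝ) = 6 * (m + n ^ 2) := by rw [hL, hm, hn]; push_cast; ring
  have hLpos : (0 : ℝ) < L := by rw [hLr]; positivity
  rw [← hLr] at hωβ
  have hsmall : ∀ ω : ℝ, 0 ≤ ω → n * m * ((2 * R + 3) * ω) ≤ 2 * v → ω ≤ 2 / 5 := by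
    intro ω h0 h
    have : 5 * ω ≤ (2 * R + 3) * ω := by nlinarith
    have : (2 * R + 3) * ω ≤ n * m * ((2 * R + 3) * ω) :=
      le_mul_of_one_le_left (by positivity) hnm
    linarith
  have hβs := hsmall _ (by positivity) hωβ
  have hts := hsmall _ (by positivity) hωt
  set P := μ.real {A | ¬ Sharp t A} with hP
  have hreal : ∀ {k : ℕ} {S : Set (ι → κ → ℝ)}, (0 : ℝ) < k →
      k * μ S ≤ 3 * μ {A | ¬ Sharp t A} → μ.real S ≤ 3 * P / k := by
    intro k S hk h
    rw [le_div_iff₀ hk, mul_comm]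
    have := ENNReal.toReal_mono (by finiteness) h
    simpa [ENNReal.toReal_mul, measureReal_def, hP] using this
  set J : ι → Bool → Set (ι → κ → ℝ) := fun l b =>
    {A | Jump l (if b then 1 else -1) t β A ∧ ∀ i j, |A i j| ≤ R}
  set C : κ → Set (ι → κ → ℝ) := fun j => {A | (∀ i j, |A i j| ≤ R) ∧ ¬ Sharp t A ∧ ∃ x,
    IsStrictOpt A x ∧ 0 < maxPay A x - colPay A x j ∧ maxPay A x - colPay A x j ≤ 2 * n * R * β}
  set D : ι → ι → Set (ι → κ → ℝ) := fun r l => {A | r ≠ l ∧ (∀ i j, |A i j| ≤ R) ∧ ¬ Sharp t A ∧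
    ∃ x, IsStrictOpt A x ∧ 0 < x r ∧ x r ≤ β ∧ 2 * L * β < x l}
  have hJ : ∀ l b, μ.real (J l b) ≤ 3 / β / K := by
    intro l b
    have h := gaussLaw_jump_le hv ha l (s := if b then 1 else -1) (R := R)
      (by cases b <;> simp) ht.le (by linarith : t < 2 * t) hβ K (by linarith) hωt
    have h2 := ENNReal.toReal_mono (by finiteness) h
    rw [ENNReal.toReal_mul, ENNReal.toReal_natCast, ENNReal.toReal_ofReal (by positivity)] at h2
    rw [le_div_iff₀ (by exact_mod_cast hK), mul_comm]
    exact h2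
  have hC : ∀ j, μ.real (C j) ≤ 3 * P / L := by
    intro j
    refine hreal hLpos (gaussLaw_small_slack_le hv ha j ht.le (by positivity) L ?_ ?_)
    · linarith
    · refine le_of_eq_of_le ?_ hωβ
      ring
  have hD : ∀ r l, μ.real (D r l) ≤ 3 * P / L := by
    intro r l
    by_cases hrl : r = l
    · have : D r l = ∅ := by
        ext A; simp [D, hrl]
      rw [this, measureReal_empty]; positivity
    have hle : 4 * R * L * β ≤ 4 * n * R * L * β := by
      have : 4 * n * R * L * β = n * (4 * R * L * β) := by ring
      rw [this]
      exact le_mul_of_one_le_left (by positivity) hn1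
    have h := gaussLaw_small_coord_le (R := R) hv ha hrl ht.le hβ L
      (by linarith) (le_trans (by gcongr) hωβ)
    refine (measureReal_mono ?_).trans (hreal hLpos h)
    exact fun A hA => hA.2
  have hsub : {A | ¬ Sharp t A} ⊆ {A | ∀ i j, |A i j| ≤ R}ᶜ ∪
      {A | ∃ x w, IsOpt A x ∧ IsOpt A w ∧ x ≠ w} ∪ (⋃ l, ⋃ b, J l b) ∪ (⋃ j, C j) ∪
      (⋃ r, ⋃ l, D r l) := by
    intro A hA
    by_contra hcon
    simp only [Set.mem_union, Set.mem_iUnion, not_or, not_exists] at hcon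
    obtain ⟨⟨⟨⟨h1, h2⟩, h3⟩, h4⟩, h5⟩ := hcon
    have hAR : ∀ i j, |A i j| ≤ R := not_not.1 h1
    obtain ⟨x, hx⟩ := exists_isOpt A
    have hxs : IsStrictOpt A x := hx.isStrictOpt fun w hw => by
      by_contra hne
      exact h2 ⟨w, x, hw, hx, hne⟩
    have hcol : ∀ j, colPay A x j = maxPay A x ∨
        2 * Fintype.card ι * R * β < maxPay A x - colPay A x j := by
      intro j
      by_contra hc
      rw [not_or, not_lt] at hc
      exact h4 j ⟨hAR, hA, x, hxs,
        sub_pos.2 (lt_of_le_of_ne (colPay_le_maxPay A x j) hc.1), hc.2⟩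
    obtain ⟨l, hl⟩ : ∃ l, 1 / n ≤ x l := by
      by_contra hc
      push Not at hc
      have := Finset.sum_lt_sum_of_nonempty Finset.univ_nonempty fun i (_ : i ∈ Finset.univ) => hc i
      rw [hx.1.2, Finset.sum_const, Finset.card_univ, nsmul_eq_mul, ← hn,
        mul_one_div_cancel (by positivity)] at this
      exact lt_irrefl _ this
    -- The largest coordinate, at least `1 / n`, can donate the mass moved by all `L` shears.
    have hLβ : 2 * L * β < 1 / n := by
      rw [lt_div_iff₀ (by positivity)]
      have h6 : 2 * (2 * L * β * n) ≤ 4 * n * R * L * β := by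
        have : 4 * n * R * L * β = R * (2 * (2 * L * β * n)) := by ring
        rw [this]
        exact le_mul_of_one_le_left (by positivity) hR
      linarith
    have hL1 : (1 : ℝ) ≤ L := by rw [hLr]; nlinarith
    have hrow : ∀ r, x r = 0 ∨ β < x r := by
      intro r
      by_contra hc
      rw [not_or, not_lt] at hc
      have hne : r ≠ l := by
        rintro rfl
        have : β ≤ 2 * L * β := by nlinarith
        linarith [hc.2]
      exact h5 r l ⟨hne, hAR, hA, x, hxs, lt_of_le_of_ne (hx.1.1 r) (Ne.symm hc.1), hc.2,
        hLβ.trans_le hl⟩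
    obtain ⟨l', s, hs, hjump⟩ := exists_jump_of_gap hx hAR hβ hcol hrow hA
    obtain ⟨w, hw⟩ := exists_isOpt (rowShift l' (-(s * t)) A)
    rcases hs with rfl | rfl
    · exact h3 l' true ⟨⟨x, w, hx, by simpa using hw, by simpa using hjump w hw⟩, hAR⟩
    · exact h3 l' false ⟨⟨x, w, hx, by simpa using hw, by simpa using hjump w hw⟩, hAR⟩
  have hNU : μ.real {A | ∃ x w, IsOpt A x ∧ IsOpt A w ∧ x ≠ w} = 0 := by
    rw [measureReal_def, hμ, gaussLaw_not_unique hv ha, ENNReal.toReal_zero]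
  have hUJ : μ.real (⋃ l, ⋃ b, J l b) ≤ n * (2 * (3 / β / K)) := by
    refine (measureReal_iUnion_fintype_le _).trans ?_
    refine (Finset.sum_le_sum fun l _ => (measureReal_iUnion_fintype_le _).trans
      (Finset.sum_le_sum fun b _ => hJ l b)).trans_eq ?_
    simp [hn]
  have hUC : μ.real (⋃ j, C j) ≤ m * (3 * P / L) := by
    refine (measureReal_iUnion_fintype_le _).trans ?_
    refine (Finset.sum_le_sum fun j _ => hC j).trans_eq ?_
    simp [hm]
  have hUD : μ.real (⋃ r, ⋃ l, D r l) ≤ n * (n * (3 * P / L)) := by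
    refine (measureReal_iUnion_fintype_le _).trans ?_
    refine (Finset.sum_le_sum fun r _ => (measureReal_iUnion_fintype_le _).trans
      (Finset.sum_le_sum fun l _ => hD r l)).trans_eq ?_
    simp [hn]
  have htot : P ≤ μ.real {A | ∀ i j, |A i j| ≤ R}ᶜ + n * (2 * (3 / β / K))
      + m * (3 * P / L) + n * (n * (3 * P / L)) := by
    refine (measureReal_mono hsub).trans ?_
    refine (measureReal_union_le _ _).trans (add_le_add ?_ hUD)
    refine (measureReal_union_le _ _).trans (add_le_add ?_ hUC)
    refine (measureReal_union_le _ _).trans (add_le_add ?_ hUJ)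
    refine (measureReal_union_le _ _).trans ?_
    rw [hNU, add_zero]
  have hhalf : m * (3 * P / L) + n * (n * (3 * P / L)) = P / 2 := by
    rw [hLr]
    field_simp
    ring
  have hfin : 12 * n / (β * K) = 2 * (n * (2 * (3 / β / K))) := by
    field_simp
    ring
  rw [hfin]
  linarith

end Bounds

/-! ### Tail bound, exchange of players, and the law of the perturbed game. -/

section Laws

open scoped ENNReal NNReal

variable {ι κ : Type*} [Fintype ι] [Fintype κ]

/-- Chebyshev for each entry and a union bound; polynomial tails suffice. -/
lemma gaussLaw_tail_le {a : ι → κ → ℝ} {v : ℝ≥0} (hv1 : v ≤ 1) (ha : ∀ i j, |a i j| ≤ 1) {R : ℝ}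
    (hR : 1 < R) :
    (gaussLaw a v).real {A | ∀ i j, |A i j| ≤ R}ᶜ ≤
      Fintype.card ι * Fintype.card κ / (R - 1) ^ 2 := by
  have hR' : 0 < R - 1 := sub_pos.2 hR
  have hentry : ∀ i j, (gaussLaw a v).real {A | R < |A i j|} ≤ 1 / (R - 1) ^ 2 := by
    intro i j
    have hmp : MeasurePreserving (fun A : ι → κ → ℝ => A i j) (gaussLaw a v)
        (gaussianReal (a i j) v) :=
      (measurePreserving_eval (fun j => gaussianReal (a i j) v) j).comp
        (measurePreserving_eval (fun i => Measure.pi fun j => gaussianReal (a i j) v) i)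
    have hms : MeasurableSet {x : ℝ | R < |x|} := measurableSet_lt (by fun_prop) (by fun_prop)
    have h1 : gaussLaw a v {A | R < |A i j|} = gaussianReal (a i j) v {x | R < |x|} :=
      hmp.measure_preimage hms.nullMeasurableSet
    have h2 := meas_ge_le_variance_div_sq (memLp_id_gaussianReal (μ := a i j) (v := v) 2) hR'
    have h3 : {x : ℝ | R < |x|} ⊆ {x | R - 1 ≤ |id x - ∫ x, id x ∂gaussianReal (a i j) v|} := by
      intro x hx
      have hx : R < |x| := hx
      have := ha i j
      have := abs_sub_abs_le_abs_sub x (a i j)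
      simp only [Set.mem_ofPred_eq, id, integral_id_gaussianReal]
      linarith
    rw [measureReal_def, h1]
    refine ENNReal.toReal_le_of_le_ofReal (by positivity) ((measure_mono h3).trans (h2.trans ?_))
    rw [variance_id_gaussianReal]
    refine ENNReal.ofReal_le_ofReal ?_
    gcongr
    exact_mod_cast hv1
  have hsub : {A : ι → κ → ℝ | ∀ i j, |A i j| ≤ R}ᶜ ⊆ ⋃ i, ⋃ j, {A | R < |A i j|} := by
    intro A hA
    simp only [Set.mem_compl_iff, Set.mem_ofPred_eq, not_forall, not_le] at hA
    simpa using hA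
  refine (measureReal_mono hsub).trans ((measureReal_iUnion_fintype_le _).trans ?_)
  refine (Finset.sum_le_sum fun i _ => (measureReal_iUnion_fintype_le _).trans
    (Finset.sum_le_sum fun j _ => hentry i j)).trans_eq ?_
  simp
  ring

/-- The game with the roles of the players exchanged. -/
def swapGame (A : ι → κ → ℝ) : κ → ι → ℝ := fun j i => -A i j

lemma measurePreserving_curry (ν : ι → κ → Measure ℝ) [∀ i j, IsProbabilityMeasure (ν i j)] :
    MeasurePreserving (MeasurableEquiv.curry ι κ ℝ) (Measure.pi fun p : ι × κ => ν p.1 p.2)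
      (Measure.pi fun i => Measure.pi fun j => ν i j) := by
  refine ⟨(MeasurableEquiv.curry ι κ ℝ).measurable, ?_⟩
  have := Measure.infinitePi_map_curry ν
  simpa only [Measure.infinitePi_eq_pi] using this

lemma measurePreserving_swapGame (a : ι → κ → ℝ) (v : ℝ≥0) :
    MeasurePreserving swapGame (gaussLaw a v) (gaussLaw (swapGame a) v) := by
  have h1 := (measurePreserving_curry fun i j => gaussianReal (a i j) v).symm
  have h2 : MeasurePreserving (fun (x : ι × κ → ℝ) (p : κ × ι) => -x p.swap)
      (Measure.pi fun p : ι × κ => gaussianReal (a p.1 p.2) v)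
      (Measure.pi fun p : κ × ι => gaussianReal (swapGame a p.1 p.2) v) := by
    refine ⟨by fun_prop, ?_⟩
    refine (Measure.pi_eq fun s hs => ?_).symm
    rw [Measure.map_apply (by fun_prop) (MeasurableSet.univ_pi hs)]
    have : (fun (x : ι × κ → ℝ) (p : κ × ι) => -x p.swap) ⁻¹' Set.univ.pi s =
        Set.univ.pi fun p : ι × κ => (fun x => -x) ⁻¹' s p.swap := by
      ext x
      simp only [Set.mem_preimage, Set.mem_univ_pi, Prod.forall, Prod.swap_prod_mk]
      exact forall_comm
    rw [this, Measure.pi_pi, ← (Equiv.prodComm κ ι).prod_comp]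
    refine Finset.prod_congr rfl fun p _ => ?_
    rw [← Measure.map_apply measurable_neg (hs _), gaussianReal_map_neg]
    rfl
  have h3 := measurePreserving_curry fun j i => gaussianReal (swapGame a j i) v
  have := h3.comp (h2.comp h1)
  exact this

lemma measurePreserving_add_gaussianNoise {n m : ℕ} (a : Fin n → Fin m → ℝ) (σ : ℝ) :
    MeasurePreserving (fun G => a + G) (gaussianNoise n m σ)
      (gaussLaw a (σ ^ 2).toNNReal) := by
  refine ⟨by fun_prop, ?_⟩
  have h1 : ∀ i j, (gaussianReal 0 (σ ^ 2).toNNReal).map (fun x => a i j + x) =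
      gaussianReal (a i j) (σ ^ 2).toNNReal := fun i j => by
    rw [gaussianReal_map_const_add, zero_add]
  have h2 : ∀ i, (Measure.pi fun _ : Fin m => gaussianReal 0 (σ ^ 2).toNNReal).map
      (fun (y : Fin m → ℝ) j => a i j + y j) =
      Measure.pi fun j => gaussianReal (a i j) (σ ^ 2).toNNReal := fun i => by
    have i1 : ∀ j, SigmaFinite ((gaussianReal 0 (σ ^ 2).toNNReal).map (fun x => a i j + x)) :=
      fun j => h1 i j ▸ inferInstance
    rw [Measure.pi_map_pi (f := fun j x => a i j + x) fun j => by fun_prop]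
    simp_rw [h1]
  have i2 : ∀ i, SigmaFinite ((Measure.pi fun _ : Fin m => gaussianReal 0 (σ ^ 2).toNNReal).map
      (fun (y : Fin m → ℝ) j => a i j + y j)) := fun i => h2 i ▸ inferInstance
  have h3 := Measure.pi_map_pi (μ := fun _ : Fin n => Measure.pi fun _ : Fin m =>
    gaussianReal 0 (σ ^ 2).toNNReal) (f := fun i (y : Fin m → ℝ) j => a i j + y j)
    fun i => (by fun_prop : Measurable fun (y : Fin m → ℝ) j => a i j + y j).aemeasurable
  simp_rw [h2] at h3
  exact h3

end Laws

/-! ### Equilibria and the duality gap in terms of the two payoff functions. -/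

section Equilibria

variable {n m : ℕ}

lemma payoff_eq_sum_colPay (A : Matrix (Fin n) (Fin m) ℝ) (x : Fin n → ℝ) (y : Fin m → ℝ) :
    payoff A x y = ∑ j, y j * colPay A x j := by
  simp only [payoff, colPay, dotProduct, Matrix.mulVec, Finset.mul_sum]
  rw [Finset.sum_comm]
  exact Finset.sum_congr rfl fun j _ => Finset.sum_congr rfl fun i _ => by ring

lemma payoff_eq_neg_sum_colPay (A : Matrix (Fin n) (Fin m) ℝ) (x : Fin n → ℝ) (y : Fin m → ℝ) :
    payoff A x y = -∑ i, x i * colPay (swapGame A) y i := by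
  simp [payoff, colPay, dotProduct, Matrix.mulVec, Finset.mul_sum, swapGame, mul_comm]

lemma payoff_single_right (A : Matrix (Fin n) (Fin m) ℝ) (x : Fin n → ℝ) (j : Fin m) :
    payoff A x (Pi.single j 1) = colPay A x j := by
  simp [payoff_eq_sum_colPay, Pi.single_apply]

lemma payoff_single_left (A : Matrix (Fin n) (Fin m) ℝ) (y : Fin m → ℝ) (i : Fin n) :
    payoff A (Pi.single i 1) y = -colPay (swapGame A) y i := by
  simp [payoff_eq_neg_sum_colPay, Pi.single_apply]

lemma payoff_le_maxPay [Nonempty (Fin m)] (A : Matrix (Fin n) (Fin m) ℝ) (x : Fin n → ℝ)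
    {y : Fin m → ℝ} (hy : y ∈ stdSimplex ℝ (Fin m)) : payoff A x y ≤ maxPay A x := by
  rw [payoff_eq_sum_colPay]
  calc ∑ j, y j * colPay A x j ≤ ∑ j, y j * maxPay A x := Finset.sum_le_sum fun j _ =>
        mul_le_mul_of_nonneg_left (colPay_le_maxPay A x j) (hy.1 j)
    _ = maxPay A x := by rw [← Finset.sum_mul, hy.2, one_mul]

lemma neg_payoff_le_maxPay [Nonempty (Fin n)] (A : Matrix (Fin n) (Fin m) ℝ) {x : Fin n → ℝ}
    (y : Fin m → ℝ) (hx : x ∈ stdSimplex ℝ (Fin n)) : -payoff A x y ≤ maxPay (swapGame A) y := by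
  rw [payoff_eq_neg_sum_colPay, neg_neg]
  calc ∑ i, x i * colPay (swapGame A) y i ≤ ∑ i, x i * maxPay (swapGame A) y :=
        Finset.sum_le_sum fun i _ =>
          mul_le_mul_of_nonneg_left (colPay_le_maxPay _ y i) (hx.1 i)
    _ = maxPay (swapGame A) y := by rw [← Finset.sum_mul, hx.2, one_mul]

lemma le_dualityGap [Nonempty (Fin n)] [Nonempty (Fin m)] (A : Matrix (Fin n) (Fin m) ℝ)
    (x : Fin n → ℝ) (y : Fin m → ℝ) :
    maxPay A x + maxPay (swapGame A) y ≤ dualityGap A x y := by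
  obtain ⟨j, hj⟩ := exists_colPay_eq A x
  obtain ⟨i, hi⟩ := exists_colPay_eq (swapGame A) y
  have h1 : maxPay A x ≤ ⨆ y' : stdSimplex ℝ (Fin m), payoff A x y' := by
    rw [hj, ← payoff_single_right]
    exact le_ciSup (f := fun y' : stdSimplex ℝ (Fin m) => payoff A x y')
      ⟨maxPay A x, by rintro _ ⟨y', rfl⟩; exact payoff_le_maxPay A x y'.2⟩
      ⟨_, single_mem_stdSimplex ℝ j⟩
  have h2 : ⨅ x' : stdSimplex ℝ (Fin n), payoff A x' y ≤ -maxPay (swapGame A) y := by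
    rw [hi, ← payoff_single_left]
    exact ciInf_le (f := fun x' : stdSimplex ℝ (Fin n) => payoff A x' y)
      ⟨-maxPay (swapGame A) y, by
        rintro _ ⟨x', rfl⟩; exact neg_le.1 (neg_payoff_le_maxPay A y x'.2)⟩
      ⟨_, single_mem_stdSimplex ℝ i⟩
  unfold dualityGap
  linarith

lemma isOpt_of_mem_equilibria [Nonempty (Fin n)] [Nonempty (Fin m)]
    {A : Matrix (Fin n) (Fin m) ℝ} {z : (Fin n → ℝ) × (Fin m → ℝ)} (hz : z ∈ equilibria A) :
    IsOpt A z.1 ∧ IsOpt (swapGame A) z.2 := by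
  obtain ⟨h1, h2, h3, h4⟩ := hz
  refine ⟨⟨h1, fun x hx => ?_⟩, ⟨h2, fun y hy => ?_⟩⟩
  · refine maxPay_le fun j => ?_
    rw [← payoff_single_right]
    exact (h4 _ (single_mem_stdSimplex ℝ j)).trans ((h3 x hx).trans (payoff_le_maxPay A x h2))
  · refine maxPay_le fun i => ?_
    have h5 := h3 _ (single_mem_stdSimplex ℝ i)
    rw [payoff_single_left] at h5
    have := neg_payoff_le_maxPay A y h1
    have := h4 y hy
    linarith

lemma exists_mem_equilibria [Nonempty (Fin n)] [Nonempty (Fin m)]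
    (A : Matrix (Fin n) (Fin m) ℝ) : (equilibria A).Nonempty := by
  have hy : ∀ x : Fin n → ℝ, IsLinearMap ℝ fun y => payoff A x y := fun x =>
    ⟨fun y z => by simp [payoff, Matrix.mulVec_add], fun c y => by
      simp [payoff, Matrix.mulVec_smul]⟩
  have hx : ∀ y : Fin m → ℝ, IsLinearMap ℝ fun x => payoff A x y := fun y =>
    ⟨fun x z => by simp [payoff], fun c x => by simp [payoff]⟩
  obtain ⟨a, ha, b, hb, hab⟩ := Sion.exists_isSaddlePointOn (f := fun x y => payoff A x y)
    ⟨_, single_mem_stdSimplex ℝ (Classical.arbitrary (Fin n))⟩ (convex_stdSimplex ℝ (Fin n))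
    (isCompact_stdSimplex ℝ (Fin n))
    (fun y _ => ((hx y).mk' _).continuous_of_finiteDimensional.lowerSemicontinuous
      |>.lowerSemicontinuousOn _)
    (fun y _ => (((hx y).mk' _).convexOn (convex_stdSimplex ℝ (Fin n))).quasiconvexOn)
    (convex_stdSimplex ℝ (Fin m))
    ⟨_, single_mem_stdSimplex ℝ (Classical.arbitrary (Fin m))⟩ (isCompact_stdSimplex ℝ (Fin m))
    (fun x _ => ((hy x).mk' _).continuous_of_finiteDimensional.upperSemicontinuous
      |>.upperSemicontinuousOn _)
    (fun x _ => (((hy x).mk' _).concaveOn (convex_stdSimplex ℝ (Fin m))).quasiconcaveOn)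
  exact ⟨(a, b), ha, hb, fun x hx => hab x hx b hb, fun y hy => hab a ha y hy⟩

lemma norm_concatStrategies_sub_le [Nonempty (Fin n)] [Nonempty (Fin m)] (x a : Fin n → ℝ)
    (y b : Fin m → ℝ) :
    ‖concatStrategies x y - concatStrategies a b‖ ≤ (n + m) * (‖x - a‖ + ‖y - b‖) := by
  have hn : (1 : ℝ) ≤ n := by exact_mod_cast Fin.pos_iff_nonempty.2 ‹_›
  have hm : (1 : ℝ) ≤ m := by exact_mod_cast Fin.pos_iff_nonempty.2 ‹_›
  rw [EuclideanSpace.norm_eq, Real.sqrt_le_left (by positivity), Fintype.sum_sum_type]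
  have h1 : ∑ i, ‖(concatStrategies x y - concatStrategies a b) (Sum.inl i)‖ ^ 2
      ≤ n * ‖x - a‖ ^ 2 := by
    refine (Finset.sum_le_sum (g := fun _ => ‖x - a‖ ^ 2) fun i _ => ?_).trans_eq (by simp)
    have := norm_le_pi_norm (x - a) i
    simp only [concatStrategies, PiLp.sub_apply, Sum.elim_inl]
    gcongr
    exact this
  have h2 : ∑ i, ‖(concatStrategies x y - concatStrategies a b) (Sum.inr i)‖ ^ 2
      ≤ m * ‖y - b‖ ^ 2 := by
    refine (Finset.sum_le_sum (g := fun _ => ‖y - b‖ ^ 2) fun i _ => ?_).trans_eq (by simp)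
    have := norm_le_pi_norm (y - b) i
    simp only [concatStrategies, PiLp.sub_apply, Sum.elim_inr]
    gcongr
    exact this
  have hX := norm_nonneg (x - a)
  have hY := norm_nonneg (y - b)
  set X := ‖x - a‖
  set Y := ‖y - b‖
  calc _ ≤ n * X ^ 2 + m * Y ^ 2 := add_le_add h1 h2
    _ ≤ (n + m) * (X + Y) ^ 2 := by nlinarith [mul_nonneg hX hY]
    _ ≤ (n + m) ^ 2 * (X + Y) ^ 2 := by gcongr; nlinarith
    _ = ((n + m) * (X + Y)) ^ 2 := by ring

/-- If both players have sharp minimax strategies, the equilibrium is unique and the distance to it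
is bounded by the duality gap. -/
lemma error_bound_of_sharp [Nonempty (Fin n)] [Nonempty (Fin m)] {A : Matrix (Fin n) (Fin m) ℝ}
    {t : ℝ} (ht : 0 < t) (h1 : Sharp t A) (h2 : Sharp t (swapGame A)) :
    ∃ xs ys, equilibria A = {(xs, ys)} ∧ ∀ ε : ℝ, ∀ x ∈ stdSimplex ℝ (Fin n),
      ∀ y ∈ stdSimplex ℝ (Fin m), dualityGap A x y ≤ ε → 0 ≤ ε ∧
        ‖concatStrategies x y - concatStrategies xs ys‖ ≤ ε * ((n + m) / t) := by
  obtain ⟨xs, hxs, hx⟩ := h1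
  obtain ⟨ys, hys, hy⟩ := h2
  have huniq : ∀ z ∈ equilibria A, z = (xs, ys) := fun z hz => by
    have := isOpt_of_mem_equilibria hz
    exact Prod.ext (Sharp.unique ht hxs hx this.1) (Sharp.unique ht hys hy this.2)
  obtain ⟨z, hz⟩ := exists_mem_equilibria A
  refine ⟨xs, ys, Set.eq_singleton_iff_unique_mem.2 ⟨huniq z hz ▸ hz, huniq⟩,
    fun ε x hxm y hym hε => ?_⟩
  have e1 := hx x hxm
  have e2 := hy y hym
  have e3 := le_dualityGap A x y
  have e4 := payoff_le_maxPay A xs hys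
  have e5 := neg_payoff_le_maxPay A ys hxs
  -- By `e4` and `e5` the two minimal worst-case payoffs have nonnegative sum, so they can be
  -- dropped.
  have e6 : t * (‖x - xs‖ + ‖y - ys‖) ≤ ε := by linarith
  refine ⟨le_trans (by positivity) e6, (norm_concatStrategies_sub_le x xs y ys).trans ?_⟩
  rw [mul_div_assoc', le_div_iff₀ ht]
  calc (n + m) * (‖x - xs‖ + ‖y - ys‖) * t = (n + m) * (t * (‖x - xs‖ + ‖y - ys‖)) := by ring
    _ ≤ (n + m) * ε := by gcongr
    _ = ε * (n + m) := by ring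

end Equilibria

/-! ### Choice of parameters and the main theorem. -/

section Main

open scoped NNReal

/-- `β` and `t` are set so that the two displacement conditions become equalities after bounding the
dimensions by `s` and `2 * R + 3` by `5 * R`. `R` and `K` make the tail and jump terms at most `1 /
(4 * Q)` each. -/
lemma gaussLaw_not_sharp_le_of_param {ι κ : Type*} [Fintype ι] [Fintype κ] [Nonempty ι]
    [Nonempty κ] {a : ι → κ → ℝ} (ha : ∀ i j, |a i j| ≤ 1) {σ s Q R β t : ℝ} {K : ℕ} (hσ : 0 < σ)
    (hσ1 : σ ^ 2 ≤ 1) (hs : s = Fintype.card ι + Fintype.card κ) (hQ : 1 ≤ Q)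
    (hR : R = 1 + 8 * s ^ 2 * Q) (hβ : β = σ ^ 2 / (120 * s ^ 5 * R ^ 2)) (hK0 : 0 < K)
    (hK : 48 * s * Q / β ≤ K) (ht : t = σ ^ 2 / (5 * s ^ 2 * R * K)) :
    (gaussLaw a (σ ^ 2).toNNReal).real {A | ¬ Sharp t A} ≤ 1 / (2 * Q) := by
  have hv : ((σ ^ 2).toNNReal : ℝ) = σ ^ 2 := Real.coe_toNNReal _ (by positivity)
  have hv0 : (σ ^ 2).toNNReal ≠ 0 := by
    rw [Ne, Real.toNNReal_eq_zero, not_le]; positivity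
  have hv1 : (σ ^ 2).toNNReal ≤ 1 := by rw [Real.toNNReal_le_one]; exact hσ1
  have hn1 : (1 : ℝ) ≤ Fintype.card ι := by exact_mod_cast Fintype.card_pos
  have hm1 : (1 : ℝ) ≤ Fintype.card κ := by exact_mod_cast Fintype.card_pos
  have hs1 : 1 ≤ s := by linarith
  have hns : (Fintype.card ι : ℝ) ≤ s := by linarith
  have hms : (Fintype.card κ : ℝ) ≤ s := by linarith
  have hKr : (0 : ℝ) < K := by exact_mod_cast hK0
  have hR1 : 1 < R := by rw [hR]; linarith [show 0 < 8 * s ^ 2 * Q by positivity]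
  have hRpos : 0 < R := by linarith
  have hβ0 : 0 < β := by rw [hβ]; positivity
  have ht0 : 0 < t := by rw [ht]; positivity
  have h5 : 2 * R + 3 ≤ 5 * R := by linarith
  have hnm : (Fintype.card ι : ℝ) * Fintype.card κ ≤ s ^ 2 := by nlinarith
  have hmn : (Fintype.card κ : ℝ) + Fintype.card ι ^ 2 ≤ 2 * s ^ 2 := by nlinarith
  have key := gaussLaw_not_sharp_le hv0 hv1 ha ht0 hβ0 hR1.le K hK0 (by
    rw [hv]
    calc (Fintype.card ι : ℝ) * Fintype.card κ * ((2 * R + 3) * (4 * Fintype.card ι * R *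
          (6 * (Fintype.card κ + Fintype.card ι ^ 2)) * β))
        ≤ s ^ 2 * (5 * R * (4 * s * R * (6 * (2 * s ^ 2)) * β)) := by gcongr
      _ = 2 * σ ^ 2 := by rw [hβ]; field_simp; norm_num) (by
    rw [hv]
    calc (Fintype.card ι : ℝ) * Fintype.card κ * ((2 * R + 3) * (K * (2 * t)))
        ≤ s ^ 2 * (5 * R * (K * (2 * t))) := by gcongr
      _ = 2 * σ ^ 2 := by rw [ht]; field_simp)
  have htail := gaussLaw_tail_le hv1 ha hR1
  have h1 : (Fintype.card ι : ℝ) * Fintype.card κ / (R - 1) ^ 2 ≤ 1 / (8 * Q) := by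
    rw [div_le_div_iff₀ (by rw [hR]; ring_nf; positivity) (by positivity), hR]
    have e1 : s ^ 2 * (8 * Q) ≤ (s ^ 2 * (8 * Q)) * (s ^ 2 * (8 * Q)) :=
      le_mul_of_one_le_left (by positivity) (by nlinarith)
    calc (Fintype.card ι : ℝ) * Fintype.card κ * (8 * Q) ≤ s ^ 2 * (8 * Q) := by gcongr
      _ ≤ _ := e1
      _ = 1 * (1 + 8 * s ^ 2 * Q - 1) ^ 2 := by ring
  have h2 : 12 * Fintype.card ι / (β * K) ≤ 1 / (4 * Q) := by
    rw [div_le_div_iff₀ (by positivity) (by positivity)]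
    rw [div_le_iff₀ hβ0] at hK
    have : (Fintype.card ι : ℝ) * Q ≤ s * Q := by gcongr
    linarith
  have h3 : 2 * (1 / (8 * Q)) + 1 / (4 * Q) = 1 / (2 * Q) := by field_simp; norm_num
  linarith

theorem mainTheorem9 (q : Polynomial ℝ) (hq : ∀ k : ℕ, 0 < k → 0 < q.eval (k : ℝ)) :
    ∃ p : MvPolynomial (Fin 3) ℝ,
      ∀ (n m : ℕ), 0 < n → 0 < m →
      ∀ (Abar : Matrix (Fin n) (Fin m) ℝ), (∀ i j, Abar i j ∈ Set.Icc (-1 : ℝ) 1) →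
      ∀ σ : ℝ, 0 < σ → σ ^ 2 ≤ 1 →
      ∃ E : Set (Fin n → Fin m → ℝ), MeasurableSet E ∧
        1 - 1 / q.eval ((n : ℝ) * (m : ℝ)) ≤ (gaussianNoise n m σ).real E ∧
        ∀ G ∈ E, ∃ (xs : Fin n → ℝ) (ys : Fin m → ℝ),
          equilibria (Abar + Matrix.of G) = {(xs, ys)} ∧
          ∀ (ε : ℝ), ∀ x ∈ stdSimplex ℝ (Fin n), ∀ y ∈ stdSimplex ℝ (Fin m),
            dualityGap (Abar + Matrix.of G) x y ≤ ε →
              ‖concatStrategies x y - concatStrategies xs ys‖ ≤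
                ε * MvPolynomial.eval ![(n : ℝ), (m : ℝ), 1 / σ] p := by
  let N : MvPolynomial (Fin 3) ℝ := MvPolynomial.X 0 + MvPolynomial.X 1
  let W : MvPolynomial (Fin 3) ℝ := MvPolynomial.X 2 ^ 2
  -- The value of `q` may be below one; its square plus one is at least one and still dominates it.
  let Qp : MvPolynomial (Fin 3) ℝ :=
    (Polynomial.aeval (MvPolynomial.X 0 * MvPolynomial.X 1) q) ^ 2 + 1
  let Rp : MvPolynomial (Fin 3) ℝ := 1 + 8 * N ^ 2 * Qp
  refine ⟨N * (5 * N ^ 2 * Rp * W * (48 * N * Qp * (120 * N ^ 5 * Rp ^ 2 * W) + 1)), ?_⟩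
  intro n m hn hm Abar hA σ hσ hσ1
  have : Nonempty (Fin n) := Fin.pos_iff_nonempty.1 hn
  have : Nonempty (Fin m) := Fin.pos_iff_nonempty.1 hm
  have hn1 : (1 : ℝ) ≤ n := by exact_mod_cast hn
  have hm1 : (1 : ℝ) ≤ m := by exact_mod_cast hm
  set c := q.eval ((n : ℝ) * m) with hc
  have hcpos : 0 < c := by
    have := hq (n * m) (Nat.mul_pos hn hm)
    rwa [Nat.cast_mul] at this
  set s : ℝ := n + m with hs
  set Q : ℝ := c ^ 2 + 1 with hQ
  set R : ℝ := 1 + 8 * s ^ 2 * Q with hR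
  set β : ℝ := σ ^ 2 / (120 * s ^ 5 * R ^ 2) with hβ
  set K : ℕ := ⌈48 * s * Q / β⌉₊ with hK
  set t : ℝ := σ ^ 2 / (5 * s ^ 2 * R * K) with ht
  have hspos : 0 < s := by positivity
  have hQ1 : 1 ≤ Q := by rw [hQ]; nlinarith
  have hRpos : 0 < R := by positivity
  have hβ0 : 0 < β := by positivity
  have hK0 : 0 < K := Nat.ceil_pos.2 (by positivity)
  have hKr : (0 : ℝ) < K := by exact_mod_cast hK0
  have ht0 : 0 < t := by positivity
  have hp : s / t ≤ MvPolynomial.eval ![(n : ℝ), (m : ℝ), 1 / σ]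
      (N * (5 * N ^ 2 * Rp * W * (48 * N * Qp * (120 * N ^ 5 * Rp ^ 2 * W) + 1))) := by
    have eN : MvPolynomial.eval ![(n : ℝ), (m : ℝ), 1 / σ] N = s := by simp [N, hs]
    have eW : MvPolynomial.eval ![(n : ℝ), (m : ℝ), 1 / σ] W = (1 / σ) ^ 2 := by simp [W]
    have eQ : MvPolynomial.eval ![(n : ℝ), (m : ℝ), 1 / σ] Qp = Q := by
      simp only [Qp, map_add, map_pow, map_one, hQ, hc]
      rw [← MvPolynomial.coe_aeval_eq_eval, RingHom.coe_coe, ← Polynomial.aeval_algHom_apply]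
      simp [Polynomial.aeval_def, Polynomial.eval₂_eq_eval_map]
    have eR : MvPolynomial.eval ![(n : ℝ), (m : ℝ), 1 / σ] Rp = R := by
      simp only [Rp, map_mul, map_add, map_pow, map_one, map_ofNat, eN, eQ, hR]
    have e : MvPolynomial.eval ![(n : ℝ), (m : ℝ), 1 / σ]
        (N * (5 * N ^ 2 * Rp * W * (48 * N * Qp * (120 * N ^ 5 * Rp ^ 2 * W) + 1))) =
        s * (5 * s ^ 2 * R * (1 / σ) ^ 2 *
          (48 * s * Q * (120 * s ^ 5 * R ^ 2 * (1 / σ) ^ 2) + 1)) := by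
      simp only [map_mul, map_add, map_pow, map_one, map_ofNat, eN, eW, eQ, eR]
    rw [e]
    have hKle : (K : ℝ) ≤ 48 * s * Q * (120 * s ^ 5 * R ^ 2 * (1 / σ) ^ 2) + 1 := by
      refine (Nat.ceil_lt_add_one (by positivity)).le.trans_eq ?_
      rw [hβ]
      field_simp
    calc s / t = s * (5 * s ^ 2 * R * (1 / σ) ^ 2 * K) := by rw [ht]; field_simp
      _ ≤ _ := by gcongr
  let a : Fin n → Fin m → ℝ := Abar
  have ha : ∀ i j, |a i j| ≤ 1 := fun i j => abs_le.2 (hA i j)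
  have hmp := measurePreserving_add_gaussianNoise a σ
  have hmp' := (measurePreserving_swapGame a (σ ^ 2).toNNReal).comp hmp
  have hm1 : MeasurableSet {A : Fin n → Fin m → ℝ | Sharp t A} := (isClosed_sharp t).measurableSet
  have hm2 : MeasurableSet {A : Fin m → Fin n → ℝ | Sharp t A} := (isClosed_sharp t).measurableSet
  have hme := (hmp.measurable hm1).inter (hmp'.measurable hm2)
  refine ⟨_, hme, ?_, ?_⟩
  · have hprob : IsProbabilityMeasure (gaussianNoise n m σ) := by
      unfold gaussianNoise; infer_instance
    have b1 : (gaussianNoise n m σ).real ((fun G => a + G) ⁻¹' {A | Sharp t A})ᶜ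
        ≤ 1 / (2 * Q) := by
      rw [← Set.preimage_compl, measureReal_def, hmp.measure_preimage hm1.compl.nullMeasurableSet]
      exact gaussLaw_not_sharp_le_of_param ha hσ hσ1 (by simp [hs]) hQ1 hR hβ hK0
        (Nat.le_ceil _) ht
    have b2 : (gaussianNoise n m σ).real
        ((swapGame ∘ fun G => a + G) ⁻¹' {A | Sharp t A})ᶜ ≤ 1 / (2 * Q) := by
      rw [← Set.preimage_compl, measureReal_def, hmp'.measure_preimage hm2.compl.nullMeasurableSet]
      -- The parameters depend on the dimensions only through `n + m`, so the same ones serve the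
      -- column player.
      exact gaussLaw_not_sharp_le_of_param (fun j i => by simpa [swapGame] using ha i j) hσ hσ1
        (by simp [hs, add_comm]) hQ1 hR hβ hK0 (Nat.le_ceil _) ht
    have b3 := measureReal_compl (μ := gaussianNoise n m σ) hme
    rw [Set.compl_inter, probReal_univ] at b3
    have b4 := (measureReal_union_le (μ := gaussianNoise n m σ) _ _).trans (add_le_add b1 b2)
    rw [b3] at b4
    have b5 : 1 / (2 * Q) + 1 / (2 * Q) = 1 / Q := by field_simp; norm_num
    have b6 : 1 / Q ≤ 1 / c := by
      apply one_div_le_one_div_of_le hcpos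
      rw [hQ]; nlinarith [sq_nonneg (c - 1)]
    linarith
  · rintro G ⟨h1, h2⟩
    obtain ⟨xs, ys, heq, hb⟩ := error_bound_of_sharp (A := Abar + Matrix.of G) ht0 h1 h2
    refine ⟨xs, ys, heq, fun ε x hx y hy hε => ?_⟩
    obtain ⟨h0, hle⟩ := hb ε x hx y hy hε
    exact hle.trans (mul_le_mul_of_nonneg_left hp h0)

end Main
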